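/- Let $N,K\ge 0$ and $V\ge 1$ be integers. For $1\le n\le N$ let $\mathbf S_n\in\mathbb R^{K\times V}$ be mutually independent random matrices (the sources; row $k$ belongs to dataset $k$, column $v$ is the $v$th sample $\mathbf s_n(v)\in\mathbb R^K$), such that the $V$ samples $(\mathbf s_1(v),\dots,\mathbf s_N(v))$, $1\le v\le V$, are independent and identically distributed, and each $\mathbf s_n(v)$ has a probability density on $\mathbb R^K$, finite second moments and mean zero. Write $\mathbf s_n$ for a random vector with the common distribution of the $\mathbf s_n(v)$. Let $\mathbf A^{[1]},\dots,\mathbf A^{[K]}\in\mathbb R^{N\times N}$ be invertible and let $x_n^{[k]}(v)=\sum_{l=1}^N a^{[k]}_{n,l}\,s_l^{[k]}(v)$ be the observed mixtures. The sources are called identifiable if, for all invertible $\mathbf W^{[1]},\dots,\mathbf W^{[K]}\in\mathbb R^{N\times N}$ for which the estimated components $\mathbf Y_n\in\mathbb R^{K\times V}$, $y_n^{[k]}(v)=\sum_{l} w^{[k]}_{n,l}x_l^{[k]}(v)$, $1\le n\le N$, are mutually independent, every $(\mathbf W^{[k]})^{-1}$ is of the form $\mathbf A^{[k]}\mathbf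 P^{[k]}\boldsymbol\Lambda^{[k]}$ with $\mathbf P^{[k]}$ a permutation matrix and $\boldsymbol\Lambda^{[k]}$ a nonsingular diagonal matrix. For $\alpha\subseteq\{1,\dots,K\}$ and a random vector $\mathbf s\in\mathbb R^K$ let $\mathbf s_\alpha$ be the subvector indexed by $\alpha$ and $\mathbf R_\alpha=E[\mathbf s_\alpha\mathbf s_\alpha^{T}]$; $\mathbf s$ has an $\alpha$-Gaussian component if $\mathbf s_\alpha$ is independent of $\mathbf s_{\alpha^c}$, $\mathbf s_\alpha\sim\mathcal N(\mathbf 0,\mathbf R_\alpha)$ and $\mathbf R_\alpha$ is nonsingular. Then the sources are not identifiable if and only if there are a nonempty $\alpha\subseteq\{1,\dots,K\}$ and indices $m\ne n$ such that $\mathbf s_m$ and $\mathbf s_n$ both have $\alpha$-Gaussian components and $\mathbf R_{m,\alpha}=\mathbf D\,\mathbf R_{n,\alpha}\,\mathbf D$ for some full-rank diagonal matrix $\mathbf D$, where $\mathbf R_{m,\alpha}$ and $\mathbf R_{n,\alpha}$ are the matrices $\mathbf R_\alpha$ of $\mathbf s_m$ and $\mathbf s_n$. The case $V=1$ is included. 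-/

import Mathlib

open MeasureTheory ProbabilityTheory

/-- Linear instantaneous mixing in each of the `K` datasets. Row `n` of dataset `k` of the result is
`∑ l, A^{[k]}_{n,l} s_l^{[k]}`, where `S n ω k v` is the `v`-th sample, in dataset `k`, of the
`n`-th component (so `S n` is the `n`-th random `K × V` source component matrix). -/
def mixing {Ω : Type*} {N K V : ℕ} (A : Fin K → Matrix (Fin N) (Fin N) ℝ)
    (S : Fin N → Ω → Fin K → Fin V → ℝ) : Fin N → Ω → Fin K → Fin V → ℝ :=
  fun n ω k v => ∑ l, A k n l * S l ω k v

/-- The sources of the mixture with mixing matrices `A k` can be identified (up to scaling and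
ordering in each dataset): whenever invertible demixing matrices `W k`, applied to the observed
mixture, produce mutually independent source component matrices, the estimate `(W k)⁻¹` of the
mixing matrix equals `A k * P k * Λ k` with `P k` a permutation matrix and `Λ k` a nonsingular
diagonal matrix, in each dataset `k`. -/
def SourcesIdentifiable {Ω : Type*} [MeasurableSpace Ω] (μ : Measure Ω) {N K V : ℕ}
    (A : Fin K → Matrix (Fin N) (Fin N) ℝ) (S : Fin N → Ω → Fin K → Fin V → ℝ) : Prop :=
  ∀ W : Fin K → Matrix (Fin N) (Fin N) ℝ, (∀ k, IsUnit (W k)) →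
    iIndepFun (mixing W (mixing A S)) μ →
      ∀ k, ∃ (σ : Equiv.Perm (Fin N)) (d : Fin N → ℝ), (∀ n, d n ≠ 0) ∧
        (W k)⁻¹ = A k * σ.permMatrix ℝ * Matrix.diagonal d

/-- The second-moment matrix `R_α = E[x_α x_αᵀ]` of the subvector of `x` indexed by `α`. -/
noncomputable def secondMomentMatrix {Ω : Type*} [MeasurableSpace Ω] (μ : Measure Ω) {K : ℕ}
    (x : Ω → Fin K → ℝ) (α : Finset (Fin K)) : Matrix α α ℝ :=
  Matrix.of fun i j => ∫ ω, x ω i * x ω j ∂μ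

/-- The random vector `x` has an `α`-Gaussian component: the subvector indexed by `α` is independent
of the subvector indexed by the complement of `α`, and it is distributed as `N(0, R_α)`, with `R_α`
nonsingular. -/
structure HasAlphaGaussianComponent {Ω : Type*} [MeasurableSpace Ω] (μ : Measure Ω) {K : ℕ}
    (x : Ω → Fin K → ℝ) (α : Finset (Fin K)) : Prop where
  indep : IndepFun (fun ω (k : α) => x ω k) (fun ω (k : (αᶜ : Finset (Fin K))) => x ω k) μ
  law : HasLaw (fun ω => WithLp.toLp 2 (fun k : α => x ω k))
    (multivariateGaussian (0 : EuclideanSpace ℝ α) (secondMomentMatrix μ x α)) μ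
  nonsingular : IsUnit (secondMomentMatrix μ x α)

/-! A Gaussian pair destroys identifiability because on `α` the vectors `s_m` and `D s_n` have the
same centred Gaussian law, independent of all other coordinates. An orthogonal mixing of the two by
45 degrees, made in the datasets of `α` only, preserves the joint law of the sources
(`map_mixVec_scaledRotation`). Applied to every sample it yields independent components, yet one of
its rows combines two sources.

Conversely, let `G = W A` give independent mixtures `y` and not be monomial; one sample suffices.
Some row `n` has nonzero entries at two sources `l ≠ l'` in one dataset. The phase `exp(i z·s_l)` is
a product of functions of the separate `y_j`, so independence of the `y_j` factors its moments
against two mixtures. Expanded in the independent sources, this says that the Hessian of the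
log-characteristic function of `s_l` is constant in every entry reached by two different mixtures
(`moment_identity`). This is a Darmois–Skitovich argument, stated without division because the
characteristic function might vanish. Along lines it becomes `φ φ'' - φ'² = -κ φ²`, whose solutions
with `φ'(0) = 0` are Gaussian factors. Hence `s_l` has a Gaussian factor on all datasets in which it
enters two mixtures (`gaussianFactor`).

Second moments do the rest. Computing the cross moments of `s_l` and `y_n` in two ways
(`second_order`) shows that `G` and the transpose of its inverse have the same zeros, that the
datasets where row `n` sees both `l` and `l'` are uncorrelated with the others, and that on them the
moment matrices of `s_l` and `s_l'` are both diagonal rescalings of that of `y_n`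
(`exists_factorization`). -/

open scoped Matrix

/-! ### Characteristic functions of finite-dimensional vectors -/

/-- The unit complex number with argument `r`. -/
noncomputable def phase (r : ℝ) : ℂ := Complex.exp (r * Complex.I)

lemma phase_zero : phase 0 = 1 := by simp [phase]

lemma phase_add (r s : ℝ) : phase (r + s) = phase r * phase s := by
  simp [phase, add_mul, Complex.exp_add]

lemma norm_phase (r : ℝ) : ‖phase r‖ = 1 := Complex.norm_exp_ofReal_mul_I r

@[fun_prop]
lemma continuous_phase : Continuous phase := by unfold phase; fun_prop

@[fun_prop]
lemma measurable_phase : Measurable phase := continuous_phase.measurable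

lemma phase_sum {ι : Type*} (s : Finset ι) (f : ι → ℝ) :
    phase (∑ i ∈ s, f i) = ∏ i ∈ s, phase (f i) := by
  simp [phase, Finset.sum_mul, Complex.exp_sum]

/-- The characteristic function of a finite-dimensional random vector. -/
noncomputable def vecCharFun {Ω ι : Type*} [MeasurableSpace Ω] [Fintype ι] (μ : Measure Ω)
    (x : Ω → ι → ℝ) (z : ι → ℝ) : ℂ := ∫ ω, phase (z ⬝ᵥ x ω) ∂μ

section Uniqueness

variable {Ω : Type*} [MeasurableSpace Ω] {μ : Measure Ω}

@[fun_prop]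
lemma measurable_dotProduct_const {ι β : Type*} [Fintype ι] [MeasurableSpace β] (z : ι → ℝ)
    {x : β → ι → ℝ} (hx : Measurable x) : Measurable fun ω => z ⬝ᵥ x ω := by
  unfold dotProduct; fun_prop

lemma strongDual_pi_apply {ι : Type*} [Fintype ι] [DecidableEq ι] (L : StrongDual ℝ (ι → ℝ))
    (x : ι → ℝ) : L x = (fun i => L (Pi.single i 1)) ⬝ᵥ x := by
  have h : x = ∑ i, x i • (Pi.single i 1 : ι → ℝ) := by
    ext j; simp [Finset.sum_apply, Pi.single_apply]
  conv_lhs => rw [h]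
  rw [map_sum]
  exact Finset.sum_congr rfl fun i _ => by rw [map_smul, smul_eq_mul, mul_comm]

lemma vecCharFun_zero [IsProbabilityMeasure μ] {ι : Type*} [Fintype ι] (x : Ω → ι → ℝ) : vecCharFun μ x 0 = 1 := by
  simp [vecCharFun, phase_zero]

lemma charFunDual_map_pi {ι : Type*} [Fintype ι] [DecidableEq ι] {x : Ω → ι → ℝ}
    (hx : Measurable x) (L : StrongDual ℝ (ι → ℝ)) :
    charFunDual (μ.map x) L = vecCharFun μ x (fun i => L (Pi.single i 1)) := by
  rw [charFunDual_apply, integral_map hx.aemeasurable (by fun_prop)]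
  simp only [vecCharFun, phase, ← strongDual_pi_apply L]

lemma map_eq_of_vecCharFun_eq [IsProbabilityMeasure μ] {Ω' ι : Type*} [Fintype ι] [MeasurableSpace Ω'] {ν : Measure Ω'}
    [IsProbabilityMeasure ν] {x : Ω → ι → ℝ} {y : Ω' → ι → ℝ}
    (hx : Measurable x) (hy : Measurable y) (h : ∀ z, vecCharFun μ x z = vecCharFun ν y z) :
    μ.map x = ν.map y := by
  classical
  have := Measure.isProbabilityMeasure_map (μ := μ) hx.aemeasurable
  have := Measure.isProbabilityMeasure_map (μ := ν) hy.aemeasurable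
  apply Measure.ext_of_charFunDual
  ext L
  rw [charFunDual_map_pi hx, charFunDual_map_pi hy, h]

lemma indepFun_of_vecCharFun [IsProbabilityMeasure μ] {ι κ : Type*} [Fintype ι] [Fintype κ] {x : Ω → ι → ℝ} {y : Ω → κ → ℝ}
    (hx : Measurable x) (hy : Measurable y)
    (h : ∀ z w, ∫ ω, phase (z ⬝ᵥ x ω) * phase (w ⬝ᵥ y ω) ∂μ = vecCharFun μ x z * vecCharFun μ y w) :
    IndepFun x y μ := by
  classical
  rw [indepFun_iff_charFunDual_prod hx.aemeasurable hy.aemeasurable]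
  intro L
  rw [charFunDual_map_pi hx, charFunDual_map_pi hy, ← h, charFunDual_apply,
    integral_map (by fun_prop) (by fun_prop)]
  refine integral_congr_ae (.of_forall fun ω => ?_)
  have h1 := strongDual_pi_apply (L ∘SL ContinuousLinearMap.inl ℝ (ι → ℝ) (κ → ℝ)) (x ω)
  have h2 := strongDual_pi_apply (L ∘SL ContinuousLinearMap.inr ℝ (ι → ℝ) (κ → ℝ)) (y ω)
  have h3 : L (x ω, y ω) = (L ∘SL ContinuousLinearMap.inl ℝ (ι → ℝ) (κ → ℝ)) (x ω) +
      (L ∘SL ContinuousLinearMap.inr ℝ (ι → ℝ) (κ → ℝ)) (y ω) := by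
    simp [← map_add]
  beta_reduce
  rw [← phase_add, ← h1, ← h2, ← h3, phase]

lemma indepFun_integral_phase {ι κ : Type*} [Fintype ι] [Fintype κ] {x : Ω → ι → ℝ} {y : Ω → κ → ℝ}
    (hx : Measurable x) (hy : Measurable y) (h : IndepFun x y μ) (z : ι → ℝ) (w : κ → ℝ) :
    ∫ ω, phase (z ⬝ᵥ x ω) * phase (w ⬝ᵥ y ω) ∂μ = vecCharFun μ x z * vecCharFun μ y w :=
  h.integral_fun_comp_mul_comp (f := fun a => phase (z ⬝ᵥ a)) (g := fun a => phase (w ⬝ᵥ a))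
    hx.aemeasurable hy.aemeasurable
    (by fun_prop) (by fun_prop)

end Uniqueness

/-! ### Second moments and Gaussian components -/

section Gaussian

variable {Ω : Type*} [MeasurableSpace Ω] {μ : Measure Ω} {K : ℕ} {x : Ω → Fin K → ℝ}
  {α : Finset (Fin K)}

lemma dotProduct_secondMomentMatrix_mulVec (hx : ∀ k, MemLp (fun ω => x ω k) 2 μ) (w : α → ℝ) :
    w ⬝ᵥ secondMomentMatrix μ x α *ᵥ w = ∫ ω, (∑ k : α, w k * x ω k) ^ 2 ∂μ := by
  have hint : ∀ i j : α, Integrable (fun ω => w i * x ω i * (w j * x ω j)) μ := fun i j =>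
    ((hx i).const_mul (w i)).integrable_mul ((hx j).const_mul (w j))
  simp_rw [sq, Finset.sum_mul_sum]
  rw [integral_finsetSum _ fun i _ => integrable_finsetSum _ fun j _ => hint i j]
  simp only [dotProduct, Matrix.mulVec]
  refine Finset.sum_congr rfl fun i _ => ?_
  rw [integral_finsetSum _ fun j _ => hint i j, Finset.mul_sum]
  refine Finset.sum_congr rfl fun j _ => ?_
  rw [secondMomentMatrix, Matrix.of_apply, ← integral_mul_const, ← integral_const_mul]
  refine integral_congr_ae (.of_forall fun ω => ?_)
  ring

lemma isHermitian_secondMomentMatrix : (secondMomentMatrix μ x α).IsHermitian := by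
  ext i j
  simp [secondMomentMatrix, mul_comm]

lemma posSemidef_secondMomentMatrix (hx : ∀ k, MemLp (fun ω => x ω k) 2 μ) :
    (secondMomentMatrix μ x α).PosSemidef := by
  refine .of_dotProduct_mulVec_nonneg isHermitian_secondMomentMatrix fun w => ?_
  rw [star_trivial, dotProduct_secondMomentMatrix_mulVec hx]
  positivity

/-- A square-integrable random vector with a density is not concentrated on a hyperplane. -/
lemma integral_dotProduct_sq_pos (hm : Measurable x) (hx : ∀ k, MemLp (fun ω => x ω k) 2 μ)
    [IsProbabilityMeasure μ] (hd : μ.map x ≪ (volume : Measure (Fin K → ℝ))) {w : Fin K → ℝ}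
    (hw : w ≠ 0) : 0 < ∫ ω, (w ⬝ᵥ x ω) ^ 2 ∂μ := by
  have hL2 : MemLp (fun ω => w ⬝ᵥ x ω) 2 μ := by
    unfold dotProduct
    exact memLp_finsetSum _ fun k _ => (hx k).const_mul (w k)
  refine lt_of_le_of_ne (by positivity) fun h0 => ?_
  have h1 := (integral_eq_zero_iff_of_nonneg (fun ω => sq_nonneg (w ⬝ᵥ x ω))
    hL2.integrable_sq).1 h0.symm
  set V : Submodule ℝ (Fin K → ℝ) := LinearMap.ker (Fintype.linearCombination ℝ w) with hV
  have hVmem : ∀ v, v ∈ V ↔ w ⬝ᵥ v = 0 := by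
    intro v
    simp [hV, Fintype.linearCombination_apply, dotProduct, mul_comm]
  have hVtop : V ≠ ⊤ := by
    intro h
    obtain ⟨k, hk⟩ := Function.ne_iff.1 hw
    have := (hVmem (Pi.single k 1)).1 (h ▸ Submodule.mem_top)
    simp at this
    exact hk this
  -- A proper subspace is Lebesgue-null, hence null for the law of `x`.
  have h2 : μ.map x V = 0 := hd (Measure.addHaar_submodule volume V hVtop)
  have hVm : MeasurableSet (V : Set (Fin K → ℝ)) := V.closed_of_finiteDimensional.measurableSet
  rw [Measure.map_apply hm hVm] at h2
  have h3 : ∀ᵐ ω ∂μ, x ω ∈ V := by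
    filter_upwards [h1] with ω hω
    rw [hVmem]
    simpa using hω
  have h4 : ∀ᵐ ω ∂μ, x ω ∉ V := by
    rw [ae_iff]; simp only [not_not]; exact h2
  obtain ⟨ω, h5, h6⟩ := (h3.and h4).exists
  exact h6 h5

lemma sum_subtype_mul_eq_dotProduct (α : Finset (Fin K)) (w : α → ℝ) (v : Fin K → ℝ) :
    ∑ k : α, w k * v k = (fun k => if h : k ∈ α then w ⟨k, h⟩ else 0) ⬝ᵥ v := by
  rw [dotProduct, ← Finset.sum_subset (Finset.subset_univ α), ← Finset.sum_coe_sort α]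
  · exact Finset.sum_congr rfl fun k _ => by simp
  · intro k _ hk; simp [hk]

lemma isUnit_secondMomentMatrix (hm : Measurable x) (hx : ∀ k, MemLp (fun ω => x ω k) 2 μ)
    [IsProbabilityMeasure μ] (hd : μ.map x ≪ (volume : Measure (Fin K → ℝ))) :
    IsUnit (secondMomentMatrix μ x α) := by
  refine Matrix.PosDef.isUnit (.of_dotProduct_mulVec_pos isHermitian_secondMomentMatrix
    fun w hw => ?_)
  rw [star_trivial, dotProduct_secondMomentMatrix_mulVec hx]
  simp_rw [sum_subtype_mul_eq_dotProduct]
  refine integral_dotProduct_sq_pos hm hx hd fun h => hw ?_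
  ext k
  have := congrFun h k
  simpa using this

lemma dotProduct_eq_add_compl (α : Finset (Fin K)) (z v : Fin K → ℝ) :
    z ⬝ᵥ v = (fun k : α => z k) ⬝ᵥ (fun k : α => v k) +
      (fun k : (αᶜ : Finset (Fin K)) => z k) ⬝ᵥ (fun k : (αᶜ : Finset (Fin K)) => v k) := by
  simp only [dotProduct]
  rw [Finset.sum_coe_sort α (fun k => z k * v k), Finset.sum_coe_sort αᶜ (fun k => z k * v k),
    Finset.sum_add_sum_compl]

/-- `α`-Gaussian components in terms of characteristic functions. -/
lemma hasAlphaGaussianComponent_iff [IsProbabilityMeasure μ] (hm : Measurable x)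
    (hx : ∀ k, MemLp (fun ω => x ω k) 2 μ) :
    HasAlphaGaussianComponent μ x α ↔ IsUnit (secondMomentMatrix μ x α) ∧
      ∀ z, vecCharFun μ x z = Complex.exp (-(((fun k : α => z k) ⬝ᵥ
        secondMomentMatrix μ x α *ᵥ (fun k : α => z k) : ℝ) : ℂ) / 2) *
          vecCharFun μ x (α.piecewise 0 z) := by
  set xa : Ω → α → ℝ := fun ω k => x ω k
  set xb : Ω → (αᶜ : Finset (Fin K)) → ℝ := fun ω k => x ω k
  have hma : Measurable xa := by fun_prop
  have hmb : Measurable xb := by fun_prop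
  have hsplit : ∀ z, vecCharFun μ x z = ∫ ω, phase ((fun k : α => z k) ⬝ᵥ xa ω) *
      phase ((fun k : (αᶜ : Finset (Fin K)) => z k) ⬝ᵥ xb ω) ∂μ := by
    intro z
    simp only [vecCharFun, dotProduct_eq_add_compl α, phase_add, xa, xb]
  have hcompl : ∀ z : Fin K → ℝ, vecCharFun μ x (α.piecewise 0 z) =
      vecCharFun μ xb (fun k : (αᶜ : Finset (Fin K)) => z k) := by
    intro z
    have e1 : (fun k : α => α.piecewise 0 z k) = 0 := by
      ext k; simp
    have e2 : (fun k : (αᶜ : Finset (Fin K)) => α.piecewise 0 z k) =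
        fun k : (αᶜ : Finset (Fin K)) => z k := by
      ext k
      have := Finset.mem_compl.1 k.2
      simp [this]
    rw [hsplit, e1, e2]
    simp [phase_zero, vecCharFun]
  have hgauss : ∀ t : EuclideanSpace ℝ α, charFun (multivariateGaussian (0 : EuclideanSpace ℝ α)
      (secondMomentMatrix μ x α)) t =
      Complex.exp (-((t.ofLp ⬝ᵥ secondMomentMatrix μ x α *ᵥ t.ofLp : ℝ) : ℂ) / 2) := by
    intro t
    rw [charFun_multivariateGaussian (posSemidef_secondMomentMatrix hx)]
    simp [neg_div]
  have hmL : Measurable fun ω => WithLp.toLp 2 (xa ω) := by fun_prop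
  have hlaw : ∀ t : EuclideanSpace ℝ α, charFun (μ.map fun ω => WithLp.toLp 2 (xa ω)) t =
      vecCharFun μ xa t.ofLp := by
    intro t
    rw [charFun_apply, integral_map hmL.aemeasurable (by fun_prop)]
    simp only [vecCharFun, phase]
    rfl
  constructor
  · rintro ⟨hi, hl, hn⟩
    refine ⟨hn, fun z => ?_⟩
    rw [hcompl, hsplit, indepFun_integral_phase hma hmb hi]
    congr 1
    rw [← hgauss (WithLp.toLp 2 fun k => z k), ← hl.map_eq, hlaw]
  · rintro ⟨hn, h⟩
    have hA : ∀ w : α → ℝ, vecCharFun μ xa w =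
        Complex.exp (-((w ⬝ᵥ secondMomentMatrix μ x α *ᵥ w : ℝ) : ℂ) / 2) := by
      intro w
      -- Extension by zero turns the factorization into the characteristic function of the
      -- `α`-marginal.
      set z : Fin K → ℝ := fun k => if h : k ∈ α then w ⟨k, h⟩ else 0 with hz
      have e1 : (fun k : α => z k) = w := by ext k; simp [hz]
      have e2 : (fun k : (αᶜ : Finset (Fin K)) => z k) = 0 := by
        ext k
        have := Finset.mem_compl.1 k.2
        simp [hz, this]
      have e3 := h z
      rw [hcompl, hsplit, e1, e2, vecCharFun_zero, mul_one] at e3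
      rw [← e3]
      simp [phase_zero, vecCharFun]
    refine ⟨indepFun_of_vecCharFun hma hmb fun z w => ?_, ⟨hmL.aemeasurable, ?_⟩, hn⟩
    · set u : Fin K → ℝ := fun k => if h : k ∈ α then z ⟨k, h⟩ else
        w ⟨k, Finset.mem_compl.2 h⟩ with hu
      have e1 : (fun k : α => u k) = z := by ext k; simp [hu]
      have e2 : (fun k : (αᶜ : Finset (Fin K)) => u k) = w := by
        ext k
        have := Finset.mem_compl.1 k.2
        simp [hu, this]
      have e3 := h u
      rw [hcompl, hsplit, e1, e2] at e3
      rw [e3, hA]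
    · have := Measure.isProbabilityMeasure_map (μ := μ) hmL.aemeasurable
      apply Measure.ext_of_charFun
      ext t
      rw [hgauss, hlaw, hA]

end Gaussian

/-! ### Two differential equations on the line -/

/-- A solution of `s s'' = (s')²` on the line with `s'(0) = 0` is constant. -/
lemma eq_const_of_mul_deriv_eq_sq {s r q : ℝ → ℂ} (hs : ∀ t, HasDerivAt s (r t) t)
    (hr : ∀ t, HasDerivAt r (q t) t) (h : ∀ t, s t * q t = r t ^ 2) (h0 : r 0 = 0) (t : ℝ) :
    s t = s 0 := by
  by_cases hz : ∀ t, s t = 0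
  · rw [hz, hz]
  push Not at hz
  obtain ⟨t₁, ht₁⟩ := hz
  set c : ℂ := r t₁ / s t₁ with hc
  -- Where `s ≠ 0` the equation says that `r / s` is locally constant. Zeros of `s` are not excluded
  -- beforehand, so the set where `s` agrees with one fixed exponential of rate `c` is shown to be
  -- clopen.
  set A : Set ℝ := {t | s t * Complex.exp (-(c * t)) = s t₁ * Complex.exp (-(c * t₁)) ∧
    r t = c * s t} with hA
  have hcs : Continuous s := continuous_iff_continuousAt.2 fun t => (hs t).continuousAt
  have hcr : Continuous r := continuous_iff_continuousAt.2 fun t => (hr t).continuousAt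
  have hAcl : IsClosed A :=
    (isClosed_eq (by fun_prop) (by fun_prop)).inter (isClosed_eq hcr (by fun_prop))
  have hAne : ∀ t ∈ A, s t ≠ 0 := by
    intro t ht hst
    have := ht.1
    rw [hst, zero_mul] at this
    exact mul_ne_zero ht₁ (Complex.exp_ne_zero _) this.symm
  have hAop : IsOpen A := by
    rw [Metric.isOpen_iff]
    intro t ht
    obtain ⟨ε, hε, hball⟩ := Metric.isOpen_iff.1 (isOpen_ne.preimage hcs) t (hAne t ht)
    refine ⟨ε, hε, ?_⟩
    have hconv : Convex ℝ (Metric.ball t ε) := convex_ball t ε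
    have hquot : ∀ u ∈ Metric.ball t ε, r u / s u = r t / s t := by
      intro u hu
      refine (Metric.isOpen_ball.is_const_of_deriv_eq_zero hconv.isPreconnected
        (f := fun u => r u / s u) ?_ ?_ hu (Metric.mem_ball_self hε))
      · intro v hv
        exact ((hr v).div (hs v) (hball hv)).differentiableAt.differentiableWithinAt
      · intro v hv
        have := h v
        refine ((hr v).div (hs v) (hball hv)).deriv.trans ?_
        rw [Pi.zero_apply, div_eq_zero_iff]
        left
        linear_combination this
    have hru : ∀ u ∈ Metric.ball t ε, r u = c * s u := by
      intro u hu
      have h1 := hquot u hu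
      rw [ht.2, mul_div_cancel_right₀ _ (hAne t ht), div_eq_iff (hball hu)] at h1
      exact h1
    have hder : ∀ v : ℝ, HasDerivAt (fun u : ℝ => s u * Complex.exp (-(c * u)))
        (r v * Complex.exp (-(c * v)) + s v * (Complex.exp (-(c * v)) * (-(c * 1)))) v := by
      intro v
      refine (hs v).mul (HasDerivAt.cexp ?_)
      exact ((Complex.ofRealCLM.hasDerivAt (x := v)).const_mul c).neg
    intro u hu
    refine ⟨?_, hru u hu⟩
    rw [← ht.1]
    refine (Metric.isOpen_ball.is_const_of_deriv_eq_zero hconv.isPreconnected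
        (f := fun u : ℝ => s u * Complex.exp (-(c * u))) ?_ ?_ hu (Metric.mem_ball_self hε))
    · intro v _
      exact (hder v).differentiableAt.differentiableWithinAt
    · intro v hv
      rw [(hder v).deriv, hru v hv, Pi.zero_apply]
      ring
  have huniv : A = Set.univ := IsClopen.eq_univ ⟨hAcl, hAop⟩
    ⟨t₁, rfl, by rw [hc, div_mul_cancel₀ _ ht₁]⟩
  have hmem : ∀ t, t ∈ A := fun t => huniv ▸ Set.mem_univ t
  have hc0 : c = 0 := by
    have := (hmem 0).2
    rw [h0] at this
    exact (mul_eq_zero.1 this.symm).resolve_right (hAne 0 (hmem 0))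
  have h1 := (hmem t).1.trans (hmem 0).1.symm
  simpa [hc0] using h1

/-- If `s s'' - (s')² = -κ s²` and `s'(0) = 0`, then `s` is a centred Gaussian function. -/
lemma eq_gaussian_of_mul_deriv_sub_sq {s r q : ℝ → ℂ} {κ : ℂ} (hs : ∀ t, HasDerivAt s (r t) t)
    (hr : ∀ t, HasDerivAt r (q t) t) (h : ∀ t, s t * q t - r t ^ 2 = -κ * s t ^ 2) (h0 : r 0 = 0)
    (t : ℝ) : s t = Complex.exp (-(κ * t ^ 2) / 2) * s 0 := by
  have hq : ∀ t : ℝ, HasDerivAt (fun t : ℝ => Complex.exp (κ * (t : ℂ) ^ 2 / 2))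
      (Complex.exp (κ * (t : ℂ) ^ 2 / 2) * (κ * t)) t := by
    intro t
    refine HasDerivAt.cexp ?_
    have h1 : HasDerivAt (fun t : ℝ => (t : ℂ)) 1 t := Complex.ofRealCLM.hasDerivAt
    refine (((h1.pow 2).const_mul κ).div_const 2).congr_deriv ?_
    simp only [Nat.cast_ofNat, Nat.add_one_sub_one, pow_one, mul_one]
    ring
  have h1 : ∀ t : ℝ, HasDerivAt (fun t : ℝ => Complex.exp (κ * (t : ℂ) ^ 2 / 2) * s t)
      (Complex.exp (κ * (t : ℂ) ^ 2 / 2) * (κ * t * s t + r t)) t := by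
    intro t
    refine ((hq t).mul (hs t)).congr_deriv ?_
    ring
  have h2 : ∀ t : ℝ, HasDerivAt
      (fun t : ℝ => Complex.exp (κ * (t : ℂ) ^ 2 / 2) * (κ * t * s t + r t))
      (Complex.exp (κ * (t : ℂ) ^ 2 / 2) * (κ * t * (κ * t * s t + r t) +
        (κ * s t + κ * t * r t + q t))) t := by
    intro t
    have h1 : HasDerivAt (fun t : ℝ => κ * (t : ℂ)) (κ * 1) t :=
      (Complex.ofRealCLM.hasDerivAt (x := t)).const_mul κ
    refine ((hq t).mul ((h1.mul (hs t)).add (hr t))).congr_deriv ?_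
    simp only [Pi.add_apply, Pi.mul_apply]
    ring
  -- Multiplication by `exp(κ t² / 2)` removes the right-hand side.
  have h3 := eq_const_of_mul_deriv_eq_sq h1 h2
    (fun t => by linear_combination (Complex.exp (κ * (t : ℂ) ^ 2 / 2)) ^ 2 * h t)
    (by simp [h0]) t
  simp only [Complex.ofReal_zero] at h3
  have h4 : Complex.exp (κ * 0 ^ 2 / 2) = 1 := by simp
  rw [h4, one_mul] at h3
  rw [← h3, ← mul_assoc, ← Complex.exp_add]
  have : -(κ * (t : ℂ) ^ 2) / 2 + κ * t ^ 2 / 2 = 0 := by ring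
  rw [this, Complex.exp_zero, one_mul]

/-! ### Differentiation under the expectation -/

section Derivative

variable {Ω : Type*} [MeasurableSpace Ω] {μ : Measure Ω}

lemma MeasureTheory.Integrable.mul_phase {h : Ω → ℂ} (hh : Integrable h μ) {a : Ω → ℝ} (ha : Measurable a) :
    Integrable (fun ω => h ω * phase (a ω)) μ :=
  hh.mul_bdd (c := 1) (by fun_prop) (.of_forall fun ω => (norm_phase _).le)

lemma hasDerivAt_phase_line (a b t : ℝ) :
    HasDerivAt (fun t : ℝ => phase (a + t * b)) (b * Complex.I * phase (a + t * b)) t := by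
  unfold phase
  have h1 : HasDerivAt (fun t : ℝ => ((a + t * b : ℝ) : ℂ) * Complex.I) (b * Complex.I) t := by
    have h2 : HasDerivAt (fun t : ℝ => a + t * b) b t := by
      simpa using ((hasDerivAt_id t).mul_const b).const_add a
    exact h2.ofReal_comp.mul_const Complex.I
  exact h1.cexp.congr_deriv (mul_comm _ _)

/-- The phase has modulus one, so `‖h b‖` dominates the derivative for all `t`. The weight `h`
allows a second application, which gives the second derivative. -/
lemma hasDerivAt_integral_phase {h : Ω → ℂ} {a b : Ω → ℝ} (ha : Measurable a) (hb : Measurable b)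
    (hh : Integrable h μ) (hhb : Integrable (fun ω => h ω * (b ω * Complex.I)) μ) (t : ℝ) :
    HasDerivAt (fun t : ℝ => ∫ ω, h ω * phase (a ω + t * b ω) ∂μ)
      (∫ ω, h ω * (b ω * Complex.I) * phase (a ω + t * b ω) ∂μ) t := by
  refine (hasDerivAt_integral_of_dominated_loc_of_deriv_le (s := Set.univ)
    (F := fun t ω => h ω * phase (a ω + t * b ω))
    (F' := fun t ω => h ω * (b ω * Complex.I) * phase (a ω + t * b ω))
    (bound := fun ω => ‖h ω * (b ω * Complex.I)‖) Filter.univ_mem ?_ ?_ ?_ ?_ hhb.norm ?_).2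
  · exact .of_forall fun t => (hh.mul_phase (by fun_prop)).aestronglyMeasurable
  · exact hh.mul_phase (by fun_prop)
  · exact (hhb.mul_phase (by fun_prop)).aestronglyMeasurable
  · exact .of_forall fun ω t _ => by rw [norm_mul, norm_phase, mul_one]
  · refine .of_forall fun ω t _ => ?_
    exact ((hasDerivAt_phase_line (a ω) (b ω) t).const_mul (h ω)).congr_deriv (by ring)

end Derivative

/-! ### From moment identities to a Gaussian factor -/

section GaussianFactor

variable {Ω : Type*} [MeasurableSpace Ω] {μ : Measure Ω} [IsProbabilityMeasure μ] {K : ℕ}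
  {x : Ω → Fin K → ℝ} {α : Finset (Fin K)}

omit [IsProbabilityMeasure μ] in
lemma memLp_dotProduct (hx : ∀ k, MemLp (fun ω => x ω k) 2 μ) (w : Fin K → ℝ) :
    MemLp (fun ω => w ⬝ᵥ x ω) 2 μ := by
  unfold dotProduct
  exact memLp_finsetSum _ fun k _ => (hx k).const_mul (w k)

omit [IsProbabilityMeasure μ] in
lemma integral_dotProduct_mul_dotProduct (hx : ∀ k, MemLp (fun ω => x ω k) 2 μ)
    (v w : Fin K → ℝ) :
    ∫ ω, (v ⬝ᵥ x ω) * (w ⬝ᵥ x ω) ∂μ = ∑ p, ∑ q, v p * w q * ∫ ω, x ω p * x ω q ∂μ := by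
  have hint : ∀ i j, Integrable (fun ω => v i * x ω i * (w j * x ω j)) μ := fun i j =>
    ((hx i).const_mul (v i)).integrable_mul ((hx j).const_mul (w j))
  simp_rw [dotProduct, Finset.sum_mul_sum]
  rw [integral_finsetSum _ fun i _ => integrable_finsetSum _ fun j _ => hint i j]
  refine Finset.sum_congr rfl fun i _ => ?_
  rw [integral_finsetSum _ fun j _ => hint i j]
  refine Finset.sum_congr rfl fun j _ => ?_
  rw [← integral_const_mul]
  exact integral_congr_ae (.of_forall fun ω => by ring)

/-- With derivatives written as moments, `h1` says that the Hessian of the log-characteristic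
function is minus the covariance on `α`, and `h2` that its `α`-gradient vanishes at points supported
off `α`. Restriction to the line from `z₀` in direction `w` reduces the claim to
`eq_gaussian_of_mul_deriv_sub_sq`, evaluated at time 1. -/
lemma gaussianFactor_of_moment_identities (hm : Measurable x)
    (hx : ∀ k, MemLp (fun ω => x ω k) 2 μ)
    (h1 : ∀ p ∈ α, ∀ q ∈ α, ∀ z : Fin K → ℝ,
      vecCharFun μ x z * ∫ ω, (x ω p : ℂ) * x ω q * phase (z ⬝ᵥ x ω) ∂μ -
        (∫ ω, (x ω p : ℂ) * phase (z ⬝ᵥ x ω) ∂μ) * ∫ ω, (x ω q : ℂ) * phase (z ⬝ᵥ x ω) ∂μ =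
      (∫ ω, x ω p * x ω q ∂μ : ℝ) * vecCharFun μ x z ^ 2)
    (h2 : ∀ p ∈ α, ∀ z : Fin K → ℝ, (∀ k ∈ α, z k = 0) →
      ∫ ω, (x ω p : ℂ) * phase (z ⬝ᵥ x ω) ∂μ = 0) (z : Fin K → ℝ) :
    vecCharFun μ x z = Complex.exp (-((∫ ω, (α.piecewise z 0 ⬝ᵥ x ω) ^ 2 ∂μ : ℝ) : ℂ) / 2) *
      vecCharFun μ x (α.piecewise 0 z) := by
  set w : Fin K → ℝ := α.piecewise z 0 with hw
  set z₀ : Fin K → ℝ := α.piecewise 0 z with hz₀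
  have hzw : z = z₀ + (1 : ℝ) • w := by
    ext k; by_cases hk : k ∈ α <;> simp [hw, hz₀, hk]
  have hw0 : ∀ k, k ∉ α → w k = 0 := fun k hk => by simp [hw, hk]
  set a : Ω → ℝ := fun ω => z₀ ⬝ᵥ x ω with ha
  set b : Ω → ℝ := fun ω => w ⬝ᵥ x ω with hb
  have ham : Measurable a := by fun_prop
  have hbm : Measurable b := by fun_prop
  have hbL : MemLp b 2 μ := memLp_dotProduct hx w
  have hbI : Integrable (fun ω => (b ω : ℂ) * Complex.I) μ :=
    ((hbL.integrable (by norm_num)).ofReal).mul_const _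
  have hbI2 : Integrable (fun ω => (b ω : ℂ) * Complex.I * (b ω * Complex.I)) μ := by
    have := ((hbL.integrable_mul hbL).ofReal (𝕜 := ℂ)).mul_const (-1 : ℂ)
    refine this.congr (.of_forall fun ω => ?_)
    simp only [Pi.mul_apply, Complex.coe_algebraMap, RCLike.ofReal_mul]
    linear_combination (-(b ω : ℂ) * b ω) * Complex.I_mul_I
  have hphase : ∀ (t : ℝ) ω, a ω + t * b ω = (z₀ + t • w) ⬝ᵥ x ω := by
    intro t ω; simp [ha, hb, add_dotProduct, smul_dotProduct]
  have hd0 := fun t => hasDerivAt_integral_phase (μ := μ) (h := fun _ => (1 : ℂ)) ham hbm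
    (integrable_const _) (by simpa using hbI) t
  simp only [one_mul] at hd0
  have hd1 := fun t => hasDerivAt_integral_phase (μ := μ) ham hbm hbI hbI2 t
  simp only [hphase] at hd0 hd1
  have hxI : ∀ p, Integrable (fun ω => (x ω p : ℂ)) μ := fun p =>
    ((hx p).integrable (by norm_num)).ofReal
  have hxI2 : ∀ p q, Integrable (fun ω => (x ω p : ℂ) * x ω q) μ := fun p q => by
    simpa using ((hx p).integrable_mul (hx q)).ofReal (𝕜 := ℂ)
  have hr : ∀ u : Fin K → ℝ, ∫ ω, (b ω : ℂ) * Complex.I * phase (u ⬝ᵥ x ω) ∂μ =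
      Complex.I * ∑ p, (w p : ℂ) * ∫ ω, (x ω p : ℂ) * phase (u ⬝ᵥ x ω) ∂μ := by
    intro u
    simp_rw [← integral_const_mul]
    rw [← integral_finsetSum _ fun p _ => ((hxI p).mul_phase (by fun_prop)).const_mul _,
      ← integral_const_mul]
    refine integral_congr_ae (.of_forall fun ω => ?_)
    simp only [hb, dotProduct, Complex.ofReal_sum, Complex.ofReal_mul, Finset.sum_mul,
      Finset.mul_sum]
    exact Finset.sum_congr rfl fun p _ => by ring
  have hq : ∀ u : Fin K → ℝ,
      ∫ ω, (b ω : ℂ) * Complex.I * (b ω * Complex.I) * phase (u ⬝ᵥ x ω) ∂μ =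
      -∑ p, ∑ q, (w p : ℂ) * w q * ∫ ω, (x ω p : ℂ) * x ω q * phase (u ⬝ᵥ x ω) ∂μ := by
    intro u
    have hI : ∀ p q, Integrable (fun ω => (w p : ℂ) * w q *
        ((x ω p : ℂ) * x ω q * phase (u ⬝ᵥ x ω))) μ := fun p q =>
      ((hxI2 p q).mul_phase (by fun_prop)).const_mul _
    have hS : ∑ p, ∑ q, (w p : ℂ) * w q * ∫ ω, (x ω p : ℂ) * x ω q * phase (u ⬝ᵥ x ω) ∂μ =
        ∫ ω, ∑ p, ∑ q, (w p : ℂ) * w q * ((x ω p : ℂ) * x ω q * phase (u ⬝ᵥ x ω)) ∂μ := by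
      rw [integral_finsetSum _ fun p _ => integrable_finsetSum _ fun q _ => hI p q]
      refine Finset.sum_congr rfl fun p _ => ?_
      rw [integral_finsetSum _ fun q _ => hI p q]
      exact Finset.sum_congr rfl fun q _ => (integral_const_mul _ _).symm
    rw [hS, ← integral_neg]
    refine integral_congr_ae (.of_forall fun ω => ?_)
    have e : (b ω : ℂ) * Complex.I * (b ω * Complex.I) = -((b ω : ℂ) * b ω) := by
      linear_combination ((b ω : ℂ) * b ω) * Complex.I_mul_I
    beta_reduce
    rw [e]
    simp only [hb, dotProduct, Complex.ofReal_sum, Complex.ofReal_mul, Finset.sum_mul_sum,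
      neg_mul]
    simp only [Finset.sum_mul]
    congr 1
    exact Finset.sum_congr rfl fun p _ => Finset.sum_congr rfl fun q _ => by ring
  set κ : ℝ := ∫ ω, (w ⬝ᵥ x ω) ^ 2 ∂μ with hκ
  have hκ' : (κ : ℂ) = ∑ p, ∑ q, (w p : ℂ) * w q * (∫ ω, x ω p * x ω q ∂μ : ℝ) := by
    have := integral_dotProduct_mul_dotProduct hx w w
    simp_rw [← sq] at this
    rw [hκ, this]
    push_cast
    rfl
  -- The differential equation is `h1` contracted twice with `w`; the initial condition is `h2` at
  -- `z₀`.
  have hmain := eq_gaussian_of_mul_deriv_sub_sq (κ := (κ : ℂ)) hd0 hd1 ?_ ?_ 1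
  · rw [hzw]
    simp only [vecCharFun]
    rw [hmain]
    simp
  · intro t
    rw [hr, hq, hκ']
    set u := z₀ + t • w
    have e1 : ∀ p q, (w p : ℂ) * w q * (vecCharFun μ x u *
        (∫ ω, (x ω p : ℂ) * x ω q * phase (u ⬝ᵥ x ω) ∂μ) -
        (∫ ω, (x ω p : ℂ) * phase (u ⬝ᵥ x ω) ∂μ) * ∫ ω, (x ω q : ℂ) * phase (u ⬝ᵥ x ω) ∂μ) =
        (w p : ℂ) * w q * ((∫ ω, x ω p * x ω q ∂μ : ℝ) * vecCharFun μ x u ^ 2) := by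
      intro p q
      by_cases hp : p ∈ α
      · by_cases hq : q ∈ α
        · rw [h1 p hp q hq u]
        · simp [hw0 q hq]
      · simp [hw0 p hp]
    have e2 := Finset.sum_congr (rfl : (Finset.univ : Finset (Fin K)) = Finset.univ) fun p _ =>
      Finset.sum_congr (rfl : (Finset.univ : Finset (Fin K)) = Finset.univ) fun q _ => e1 p q
    have e3 : ∫ ω, phase (u ⬝ᵥ x ω) ∂μ = vecCharFun μ x u := rfl
    rw [e3, mul_pow, Complex.I_sq, sq (∑ p, (w p : ℂ) * _), Finset.sum_mul_sum]
    simp only [mul_sub, Finset.sum_sub_distrib] at e2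
    have e4 : ∑ p, ∑ q, (w p : ℂ) * w q * ((∫ ω, x ω p * x ω q ∂μ : ℝ) * vecCharFun μ x u ^ 2) =
        (∑ p, ∑ q, (w p : ℂ) * w q * (∫ ω, x ω p * x ω q ∂μ : ℝ)) * vecCharFun μ x u ^ 2 := by
      simp only [Finset.sum_mul, mul_assoc]
    have e5 : ∑ p, ∑ q, (w p : ℂ) * w q * (vecCharFun μ x u *
        ∫ ω, (x ω p : ℂ) * x ω q * phase (u ⬝ᵥ x ω) ∂μ) = vecCharFun μ x u *
        ∑ p, ∑ q, (w p : ℂ) * w q * ∫ ω, (x ω p : ℂ) * x ω q * phase (u ⬝ᵥ x ω) ∂μ := by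
      simp only [Finset.mul_sum]
      exact Finset.sum_congr rfl fun p _ => Finset.sum_congr rfl fun q _ => by ring
    have e6 : ∑ p, ∑ q, (w p : ℂ) * w q * ((∫ ω, (x ω p : ℂ) * phase (u ⬝ᵥ x ω) ∂μ) *
        ∫ ω, (x ω q : ℂ) * phase (u ⬝ᵥ x ω) ∂μ) =
        ∑ p, ∑ q, (w p : ℂ) * (∫ ω, (x ω p : ℂ) * phase (u ⬝ᵥ x ω) ∂μ) *
        ((w q : ℂ) * ∫ ω, (x ω q : ℂ) * phase (u ⬝ᵥ x ω) ∂μ) :=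
      Finset.sum_congr rfl fun p _ => Finset.sum_congr rfl fun q _ => by ring
    rw [e4, e5, e6] at e2
    linear_combination -e2
  · rw [hr]
    simp only [zero_smul, add_zero]
    rw [Finset.sum_eq_zero, mul_zero]
    intro p _
    by_cases hp : p ∈ α
    · rw [h2 p hp z₀ fun k hk => by simp [hz₀, hk], mul_zero]
    · simp [hw0 p hp]

omit [IsProbabilityMeasure μ] in
/-- A Gaussian factor splits along an uncorrelated set of coordinates. -/
lemma gaussianFactor_of_subset {α' : Finset (Fin K)} (hx : ∀ k, MemLp (fun ω => x ω k) 2 μ)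
    (hsub : α ⊆ α') (hcross : ∀ p ∈ α, ∀ q, q ∉ α → ∫ ω, x ω p * x ω q ∂μ = 0)
    (h : ∀ z, vecCharFun μ x z =
      Complex.exp (-((∫ ω, (α'.piecewise z 0 ⬝ᵥ x ω) ^ 2 ∂μ : ℝ) : ℂ) / 2) *
      vecCharFun μ x (α'.piecewise 0 z)) (z : Fin K → ℝ) :
    vecCharFun μ x z = Complex.exp (-((∫ ω, (α.piecewise z 0 ⬝ᵥ x ω) ^ 2 ∂μ : ℝ) : ℂ) / 2) *
      vecCharFun μ x (α.piecewise 0 z) := by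
  set v : Fin K → ℝ := α.piecewise z 0 with hv
  set w : Fin K → ℝ := α'.piecewise (α.piecewise 0 z) 0 with hw
  have e1 : α'.piecewise z 0 = v + w := by
    ext k
    by_cases hk : k ∈ α
    · simp [hv, hw, hk, hsub hk]
    · by_cases hk' : k ∈ α' <;> simp [hv, hw, hk, hk']
  have e2 : α'.piecewise 0 (α.piecewise 0 z) = α'.piecewise 0 z := by
    ext k
    by_cases hk : k ∈ α
    · simp [hsub hk]
    · by_cases hk' : k ∈ α' <;> simp [hk, hk']
  -- `v` lives on `α` and `w` on `α' \ α`, so the mixed term of the quadratic form is a sum of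
  -- vanishing correlations.
  have e3 : ∫ ω, (v ⬝ᵥ x ω) * (w ⬝ᵥ x ω) ∂μ = 0 := by
    rw [integral_dotProduct_mul_dotProduct hx]
    refine Finset.sum_eq_zero fun p _ => Finset.sum_eq_zero fun q _ => ?_
    by_cases hp : p ∈ α
    · by_cases hq : q ∈ α
      · have : w q = 0 := by simp [hw, hq, hsub hq]
        simp [this]
      · rw [hcross p hp q hq, mul_zero]
    · have : v p = 0 := by simp [hv, hp]
      simp [this]
  have hvL := memLp_dotProduct hx v
  have hwL := memLp_dotProduct hx w
  have e4 : ∫ ω, ((v + w) ⬝ᵥ x ω) ^ 2 ∂μ = ∫ ω, (v ⬝ᵥ x ω) ^ 2 ∂μ + ∫ ω, (w ⬝ᵥ x ω) ^ 2 ∂μ := by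
    have : ∀ ω, ((v + w) ⬝ᵥ x ω) ^ 2 =
        (v ⬝ᵥ x ω) ^ 2 + (w ⬝ᵥ x ω) ^ 2 + 2 * ((v ⬝ᵥ x ω) * (w ⬝ᵥ x ω)) := by
      intro ω; rw [add_dotProduct]; ring
    have i1 : Integrable (fun ω => (v ⬝ᵥ x ω) ^ 2 + (w ⬝ᵥ x ω) ^ 2) μ :=
      hvL.integrable_sq.add hwL.integrable_sq
    have i2 : Integrable (fun ω => 2 * ((v ⬝ᵥ x ω) * (w ⬝ᵥ x ω))) μ :=
      (hvL.integrable_mul hwL).const_mul 2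
    simp_rw [this]
    rw [integral_add i1 i2, integral_add hvL.integrable_sq hwL.integrable_sq,
      integral_const_mul, e3]
    ring
  rw [h z, h (α.piecewise 0 z), e1, e2, e4, ← mul_assoc, ← Complex.exp_add]
  congr 2
  push_cast
  ring

end GaussianFactor

/-! ### Splitting one member off an independent family -/

section Split

variable {Ω : Type*} [MeasurableSpace Ω] {μ : Measure Ω} {ι E : Type*} [Fintype ι] [DecidableEq ι]
  [MeasurableSpace E] [Inhabited E] {y : ι → Ω → E}

/-- In an independent family, one member is independent of the others. -/
lemma indepFun_update (hi : iIndepFun y μ) (hy : ∀ i, Measurable (y i)) (m : ι) :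
    IndepFun (y m) (fun ω => Function.update (fun j => y j ω) m default) μ := by
  have h := hi.indepFun_finset {m} {m}ᶜ disjoint_compl_right hy
  have hφ : Measurable fun v : (({m} : Finset ι) → E) => v ⟨m, Finset.mem_singleton_self m⟩ :=
    measurable_pi_apply _
  have hψ : Measurable fun v : (({m}ᶜ : Finset ι) → E) => fun j : ι =>
      if hj : j ∈ ({m}ᶜ : Finset ι) then v ⟨j, hj⟩ else default := by
    refine measurable_pi_lambda _ fun j => ?_
    by_cases hj : j ∈ ({m}ᶜ : Finset ι)
    · simp only [hj, dite_true]; exact measurable_pi_apply _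
    · simp only [hj, dite_false]; exact measurable_const
  have h2 := h.comp hφ hψ
  have e : (fun ω => Function.update (fun j => y j ω) m default) =
      (fun v : (({m}ᶜ : Finset ι) → E) => fun j : ι =>
        if hj : j ∈ ({m}ᶜ : Finset ι) then v ⟨j, hj⟩ else default) ∘ fun ω i => y i ω := by
    funext ω j
    by_cases hj : j = m
    · subst hj; simp
    · simp [hj]
  rw [e]
  exact h2

/-- The condition `hgm` expresses that `g` ignores coordinate `m`, which avoids functions on a
subtype of indices. -/
lemma integral_mul_of_update_eq (hi : iIndepFun y μ) (hy : ∀ i, Measurable (y i)) (m : ι)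
    {f : E → ℂ} {g : (ι → E) → ℂ} (hf : Measurable f) (hg : Measurable g)
    (hgm : ∀ v, g (Function.update v m default) = g v) :
    ∫ ω, f (y m ω) * g (fun j => y j ω) ∂μ =
      (∫ ω, f (y m ω) ∂μ) * ∫ ω, g (fun j => y j ω) ∂μ := by
  have hm : Measurable fun ω => Function.update (fun j => y j ω) m default :=
    measurable_pi_lambda _ fun j => by
      by_cases hj : j = m
      · subst hj; simp
      · simpa [hj] using hy j
  have h := (indepFun_update hi hy m).integral_fun_comp_mul_comp (f := f) (g := g)
    (hy m).aemeasurable hm.aemeasurable hf.aestronglyMeasurable hg.aestronglyMeasurable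
  simpa only [hgm] using h

end Split

/-! ### Independent mixtures of independent sources -/

/-- The componentwise mixtures of the random vectors `s l`. -/
def mixVec {Ω : Type*} {N K : ℕ} (G : Fin K → Matrix (Fin N) (Fin N) ℝ)
    (s : Fin N → Ω → Fin K → ℝ) : Fin N → Ω → Fin K → ℝ :=
  fun n ω k => ∑ l, G k n l * s l ω k

/-- Independent centred sources with independent mixtures. -/
structure IndepMixture {Ω : Type*} [MeasurableSpace Ω] (μ : Measure Ω) {N K : ℕ}
    (G : Fin K → Matrix (Fin N) (Fin N) ℝ) (s : Fin N → Ω → Fin K → ℝ) : Prop where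
  measurable : ∀ n, Measurable (s n)
  memLp : ∀ n k, MemLp (fun ω => s n ω k) 2 μ
  mean : ∀ n k, ∫ ω, s n ω k ∂μ = 0
  indep : iIndepFun s μ
  indep_mix : iIndepFun (mixVec G s) μ
  isUnit : ∀ k, IsUnit (G k)
  moment_pos : ∀ n k, 0 < ∫ ω, s n ω k * s n ω k ∂μ

namespace IndepMixture

variable {Ω : Type*} [MeasurableSpace Ω] {μ : Measure Ω} [IsProbabilityMeasure μ] {N K : ℕ}
  {G : Fin K → Matrix (Fin N) (Fin N) ℝ} {s : Fin N → Ω → Fin K → ℝ}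

omit [IsProbabilityMeasure μ] in
lemma measurable_apply (h : IndepMixture μ G s) (l : Fin N) (k : Fin K) :
    Measurable fun ω => s l ω k := (measurable_pi_apply k).comp (h.measurable l)

omit [IsProbabilityMeasure μ] in
lemma measurable_mixVec (h : IndepMixture μ G s) (n : Fin N) : Measurable (mixVec G s n) := by
  refine measurable_pi_lambda _ fun k => ?_
  unfold mixVec
  exact Finset.measurable_sum _ fun l _ => (h.measurable_apply l k).const_mul _

omit [IsProbabilityMeasure μ] in
lemma memLp_mixVec (h : IndepMixture μ G s) (n : Fin N) (k : Fin K) :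
    MemLp (fun ω => mixVec G s n ω k) 2 μ := by
  unfold mixVec
  exact memLp_finsetSum _ fun l _ => (h.memLp l k).const_mul _

lemma integrable_source (h : IndepMixture μ G s) (n : Fin N) (k : Fin K) :
    Integrable (fun ω => (s n ω k : ℂ)) μ := ((h.memLp n k).integrable (by norm_num)).ofReal

omit [IsProbabilityMeasure μ] in
lemma integrable_source_mul (h : IndepMixture μ G s) (m n : Fin N) (p q : Fin K) :
    Integrable (fun ω => (s m ω p : ℂ) * s n ω q) μ := by
  simpa using ((h.memLp m p).integrable_mul (h.memLp n q)).ofReal (𝕜 := ℂ)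

lemma integral_mixVec (h : IndepMixture μ G s) (n : Fin N) (k : Fin K) :
    ∫ ω, mixVec G s n ω k ∂μ = 0 := by
  unfold mixVec
  rw [integral_finsetSum _ fun l _ => ((h.memLp l k).integrable (by norm_num)).const_mul _]
  exact Finset.sum_eq_zero fun l _ => by rw [integral_const_mul, h.mean, mul_zero]

omit [IsProbabilityMeasure μ] in
/-- The sources recovered from the mixtures. -/
lemma source_eq (h : IndepMixture μ G s) (l : Fin N) (ω : Ω) (k : Fin K) :
    s l ω k = ∑ n, (G k)⁻¹ l n * mixVec G s n ω k := by
  have h1 : (G k)⁻¹ *ᵥ (G k *ᵥ fun l => s l ω k) = fun l => s l ω k := by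
    rw [Matrix.mulVec_mulVec, Matrix.nonsing_inv_mul _ ((Matrix.isUnit_iff_isUnit_det _).1
      (h.isUnit k)), Matrix.one_mulVec]
  exact (congrFun h1 l).symm

omit [IsProbabilityMeasure μ] in
lemma integral_source_mul_source (h : IndepMixture μ G s) {a b : Fin N} (hab : a ≠ b)
    (p q : Fin K) : ∫ ω, s a ω p * s b ω q ∂μ = 0 := by
  have h1 := ((h.indep.indepFun hab).comp (measurable_pi_apply p)
    (measurable_pi_apply q)).integral_fun_mul_eq_mul_integral
      (h.measurable_apply a p).aestronglyMeasurable (h.measurable_apply b q).aestronglyMeasurable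
  simp only [Function.comp_apply] at h1
  rw [h1, h.mean, zero_mul]

lemma integral_mixVec_mul_mixVec (h : IndepMixture μ G s) {m n : Fin N} (hmn : m ≠ n)
    (p q : Fin K) : ∫ ω, mixVec G s m ω p * mixVec G s n ω q ∂μ = 0 := by
  have h1 := ((h.indep_mix.indepFun hmn).comp (measurable_pi_apply p)
    (measurable_pi_apply q)).integral_fun_mul_eq_mul_integral
      ((measurable_pi_apply p).comp (h.measurable_mixVec m)).aestronglyMeasurable
      ((measurable_pi_apply q).comp (h.measurable_mixVec n)).aestronglyMeasurable
  simp only [Function.comp_apply] at h1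
  rw [h1, h.integral_mixVec, zero_mul]

omit [IsProbabilityMeasure μ] in
lemma integral_source_mul_mixVec (h : IndepMixture μ G s) (l n : Fin N) (p q : Fin K) :
    ∫ ω, s l ω p * mixVec G s n ω q ∂μ = G q n l * ∫ ω, s l ω p * s l ω q ∂μ := by
  have h1 : ∀ ω, s l ω p * mixVec G s n ω q = ∑ a, G q n a * (s l ω p * s a ω q) := by
    intro ω
    rw [mixVec, Finset.mul_sum]
    exact Finset.sum_congr rfl fun a _ => by ring
  have hI : ∀ a, Integrable (fun ω => G q n a * (s l ω p * s a ω q)) μ := fun a =>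
    ((h.memLp l p).integrable_mul (h.memLp a q)).const_mul _
  simp_rw [h1]
  rw [integral_finsetSum _ fun a _ => hI a,
    Finset.sum_eq_single l, integral_const_mul]
  · intro a _ ha
    rw [integral_const_mul, h.integral_source_mul_source ha.symm, mul_zero]
  · simp

/-- The second-order relation between sources and mixtures. -/
lemma second_order (h : IndepMixture μ G s) (l n : Fin N) (p q : Fin K) :
    G q n l * ∫ ω, s l ω p * s l ω q ∂μ =
      (G p)⁻¹ l n * ∫ ω, mixVec G s n ω p * mixVec G s n ω q ∂μ := by
  -- The moment `E[s_l^p y_n^q]` is computed twice: the left side expands `y_n` in the sources, the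
  -- right side expands `s_l` in the mixtures.
  rw [← h.integral_source_mul_mixVec]
  have h1 : ∀ ω, s l ω p * mixVec G s n ω q =
      ∑ a, (G p)⁻¹ l a * (mixVec G s a ω p * mixVec G s n ω q) := by
    intro ω
    rw [h.source_eq l ω p, Finset.sum_mul]
    exact Finset.sum_congr rfl fun a _ => by ring
  have hI : ∀ a, Integrable
      (fun ω => (G p)⁻¹ l a * (mixVec G s a ω p * mixVec G s n ω q)) μ := fun a =>
    ((h.memLp_mixVec a p).integrable_mul (h.memLp_mixVec n q)).const_mul _
  simp_rw [h1]
  rw [integral_finsetSum _ fun a _ => hI a,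
    Finset.sum_eq_single n, integral_const_mul]
  · intro a _ ha
    rw [integral_const_mul, h.integral_mixVec_mul_mixVec ha, mul_zero]
  · simp

omit [IsProbabilityMeasure μ] in
lemma sum_mul_inv (h : IndepMixture μ G s) (k : Fin K) (m n : Fin N) :
    ∑ l, G k m l * (G k)⁻¹ l n = if m = n then 1 else 0 := by
  rw [← Matrix.mul_apply, Matrix.mul_nonsing_inv _ ((Matrix.isUnit_iff_isUnit_det _).1
    (h.isUnit k)), Matrix.one_apply]

omit [IsProbabilityMeasure μ] in
lemma sum_inv_mul (h : IndepMixture μ G s) (k : Fin K) (l l' : Fin N) :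
    ∑ n, (G k)⁻¹ l n * G k n l' = if l = l' then 1 else 0 := by
  rw [← Matrix.mul_apply, Matrix.nonsing_inv_mul _ ((Matrix.isUnit_iff_isUnit_det _).1
    (h.isUnit k)), Matrix.one_apply]

/-- A vanishing variance would make row `n` of `G k` zero by `second_order`, against invertibility.
-/
lemma mixVec_moment_pos (h : IndepMixture μ G s) (n : Fin N) (k : Fin K) :
    0 < ∫ ω, mixVec G s n ω k * mixVec G s n ω k ∂μ := by
  refine lt_of_le_of_ne (integral_nonneg fun ω => mul_self_nonneg _) fun h0 => ?_
  have h1 : ∀ l, G k n l = 0 := by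
    intro l
    have := h.second_order l n k k
    rw [← h0, mul_zero] at this
    exact (mul_eq_zero.1 this).resolve_right (h.moment_pos l k).ne'
  simpa [h1] using h.sum_mul_inv k n n

lemma inv_eq_zero_iff (h : IndepMixture μ G s) (l n : Fin N) (k : Fin K) :
    (G k)⁻¹ l n = 0 ↔ G k n l = 0 := by
  have h1 := h.second_order l n k k
  have h2 := (h.moment_pos l k).ne'
  have h3 := (h.mixVec_moment_pos n k).ne'
  constructor
  · intro h0
    rw [h0, zero_mul] at h1
    exact (mul_eq_zero.1 h1).resolve_right h2
  · intro h0
    rw [h0, zero_mul] at h1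
    exact (mul_eq_zero.1 h1.symm).resolve_right h3

omit [IsProbabilityMeasure μ] in
/-- Expectations against functions of the other sources vanish. -/
lemma integral_source_mul_of_update_eq (h : IndepMixture μ G s) (a : Fin N) (p : Fin K)
    {g : (Fin N → Fin K → ℝ) → ℂ} (hg : Measurable g)
    (hga : ∀ v, g (Function.update v a default) = g v) :
    ∫ ω, (s a ω p : ℂ) * g (fun j => s j ω) ∂μ = 0 := by
  rw [integral_mul_of_update_eq h.indep h.measurable a (f := fun v => ((v p : ℝ) : ℂ))
    (by fun_prop) hg hga, integral_complex_ofReal, h.mean, Complex.ofReal_zero, zero_mul]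

omit [IsProbabilityMeasure μ] in
lemma integral_source_mul_phase (h : IndepMixture μ G s) {a l : Fin N} (hal : a ≠ l) (p : Fin K)
    (z : Fin K → ℝ) : ∫ ω, (s a ω p : ℂ) * phase (z ⬝ᵥ s l ω) ∂μ = 0 :=
  h.integral_source_mul_of_update_eq a p (g := fun v => phase (z ⬝ᵥ v l)) (by fun_prop)
    fun v => by simp [hal.symm]

omit [IsProbabilityMeasure μ] in
-- One of `a`, `b` differs from `l`; that source is centred and independent of the remaining
-- factors.
lemma integral_source_mul_source_mul_phase (h : IndepMixture μ G s) {a b : Fin N} (hab : a ≠ b)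
    (l : Fin N) (p q : Fin K) (z : Fin K → ℝ) :
    ∫ ω, (s a ω p : ℂ) * s b ω q * phase (z ⬝ᵥ s l ω) ∂μ = 0 := by
  rcases eq_or_ne a l with rfl | hal
  · rw [← h.integral_source_mul_of_update_eq b q
      (g := fun v => ((v a p : ℝ) : ℂ) * phase (z ⬝ᵥ v a)) (by fun_prop) fun v => by simp [hab]]
    exact integral_congr_ae (.of_forall fun ω => by ring)
  · rw [← h.integral_source_mul_of_update_eq a p
      (g := fun v => ((v b q : ℝ) : ℂ) * phase (z ⬝ᵥ v l)) (by fun_prop)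
      fun v => by simp [hab.symm, hal.symm]]
    exact integral_congr_ae (.of_forall fun ω => by ring)

omit [IsProbabilityMeasure μ] in
lemma integral_source_mul_self_mul_phase (h : IndepMixture μ G s) {a l : Fin N} (hal : a ≠ l)
    (p q : Fin K) (z : Fin K → ℝ) :
    ∫ ω, (s a ω p : ℂ) * s a ω q * phase (z ⬝ᵥ s l ω) ∂μ =
      (∫ ω, s a ω p * s a ω q ∂μ : ℝ) * vecCharFun μ (s l) z := by
  rw [integral_mul_of_update_eq h.indep h.measurable a
    (f := fun v => ((v p : ℝ) : ℂ) * (v q : ℝ)) (g := fun v => phase (z ⬝ᵥ v l))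
    (by fun_prop) (by fun_prop) fun v => by simp [hal.symm], ← integral_complex_ofReal]
  push_cast
  rfl

lemma integral_mixVec_mul_phase (h : IndepMixture μ G s) (n l : Fin N) (p : Fin K)
    (z : Fin K → ℝ) :
    ∫ ω, (mixVec G s n ω p : ℂ) * phase (z ⬝ᵥ s l ω) ∂μ =
      G p n l * ∫ ω, (s l ω p : ℂ) * phase (z ⬝ᵥ s l ω) ∂μ := by
  have hz : Measurable fun ω => z ⬝ᵥ s l ω := measurable_dotProduct_const z (h.measurable l)
  have h1 : ∀ ω, (mixVec G s n ω p : ℂ) * phase (z ⬝ᵥ s l ω) =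
      ∑ a, (G p n a : ℂ) * ((s a ω p : ℂ) * phase (z ⬝ᵥ s l ω)) := by
    intro ω
    simp only [mixVec, Complex.ofReal_sum, Complex.ofReal_mul, Finset.sum_mul, mul_assoc]
  simp_rw [h1]
  rw [integral_finsetSum _ fun a _ => ((h.integrable_source a p).mul_phase hz).const_mul _,
    Finset.sum_eq_single l, integral_const_mul]
  · intro a _ ha
    rw [integral_const_mul, h.integral_source_mul_phase ha, mul_zero]
  · simp

omit [IsProbabilityMeasure μ] in
lemma integral_mixVec_mul_mixVec_mul_phase (h : IndepMixture μ G s) (m n l : Fin N) (p q : Fin K)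
    (z : Fin K → ℝ) :
    ∫ ω, (mixVec G s m ω p : ℂ) * mixVec G s n ω q * phase (z ⬝ᵥ s l ω) ∂μ =
      ∑ a, (G p m a : ℂ) * G q n a * ∫ ω, (s a ω p : ℂ) * s a ω q * phase (z ⬝ᵥ s l ω) ∂μ := by
  have hz : Measurable fun ω => z ⬝ᵥ s l ω := measurable_dotProduct_const z (h.measurable l)
  have h1 : ∀ ω, (mixVec G s m ω p : ℂ) * mixVec G s n ω q * phase (z ⬝ᵥ s l ω) =
      ∑ a, ∑ b, (G p m a : ℂ) * G q n b * ((s a ω p : ℂ) * s b ω q * phase (z ⬝ᵥ s l ω)) := by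
    intro ω
    simp only [mixVec, Complex.ofReal_sum, Complex.ofReal_mul, Finset.sum_mul_sum]
    simp only [Finset.sum_mul]
    exact Finset.sum_congr rfl fun a _ => Finset.sum_congr rfl fun b _ => by ring
  have hI : ∀ a b, Integrable (fun ω => (G p m a : ℂ) * G q n b *
      ((s a ω p : ℂ) * s b ω q * phase (z ⬝ᵥ s l ω))) μ := fun a b =>
    ((h.integrable_source_mul a b p q).mul_phase hz).const_mul _
  simp_rw [h1]
  rw [integral_finsetSum _ fun a _ => integrable_finsetSum _ fun b _ => hI a b]
  refine Finset.sum_congr rfl fun a _ => ?_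
  rw [integral_finsetSum _ fun b _ => hI a b, Finset.sum_eq_single a, integral_const_mul]
  · intro b _ hb
    rw [integral_const_mul, h.integral_source_mul_source_mul_phase hb.symm, mul_zero]
  · simp

omit [IsProbabilityMeasure μ] in
-- Since `z·s_l = ∑ j, c_j·y_j`, the phase is a function of `y_m` times a function of the other
-- mixtures. All four expectations then split in the same way, and both sides are the same product.
lemma integral_mixVec_cross (h : IndepMixture μ G s) {m n : Fin N} (hmn : m ≠ n) (l : Fin N)
    (p q : Fin K) (z : Fin K → ℝ) :
    vecCharFun μ (s l) z *
      ∫ ω, (mixVec G s m ω p : ℂ) * mixVec G s n ω q * phase (z ⬝ᵥ s l ω) ∂μ =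
    (∫ ω, (mixVec G s m ω p : ℂ) * phase (z ⬝ᵥ s l ω) ∂μ) *
      ∫ ω, (mixVec G s n ω q : ℂ) * phase (z ⬝ᵥ s l ω) ∂μ := by
  set c : Fin N → Fin K → ℝ := fun j k => z k * (G k)⁻¹ l j with hc
  set e : (Fin K → ℝ) → ℂ := fun v => phase (c m ⬝ᵥ v) with he
  set e' : (Fin N → Fin K → ℝ) → ℂ :=
    fun v => ∏ j ∈ Finset.univ.erase m, phase (c j ⬝ᵥ v j) with he'
  have hem : Measurable e := by fun_prop
  have hem' : Measurable e' := by fun_prop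
  have hphase : ∀ ω, phase (z ⬝ᵥ s l ω) =
      e (mixVec G s m ω) * e' (fun j => mixVec G s j ω) := by
    intro ω
    rw [he, he']
    beta_reduce
    rw [Finset.mul_prod_erase Finset.univ (fun j => phase (c j ⬝ᵥ mixVec G s j ω))
      (Finset.mem_univ m), ← phase_sum]
    congr 1
    simp only [dotProduct]
    rw [Finset.sum_comm]
    refine Finset.sum_congr rfl fun k _ => ?_
    rw [h.source_eq l ω k, Finset.mul_sum]
    exact Finset.sum_congr rfl fun j _ => by rw [hc]; ring
  have hupd : ∀ v, e' (Function.update v m default) = e' v := fun v =>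
    Finset.prod_congr rfl fun j hj => by rw [Function.update_of_ne (Finset.ne_of_mem_erase hj)]
  have key : ∀ (f : (Fin K → ℝ) → ℂ) (g : (Fin K → ℝ) → ℂ), Measurable f → Measurable g →
      ∫ ω, f (mixVec G s m ω) * g (mixVec G s n ω) * phase (z ⬝ᵥ s l ω) ∂μ =
      (∫ ω, f (mixVec G s m ω) * e (mixVec G s m ω) ∂μ) *
        ∫ ω, g (mixVec G s n ω) * e' (fun j => mixVec G s j ω) ∂μ := by
    intro f g hf hg
    rw [← integral_mul_of_update_eq h.indep_mix h.measurable_mixVec m (f := fun v => f v * e v)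
      (g := fun v => g (v n) * e' v) (hf.mul hem)
      ((hg.comp (measurable_pi_apply n)).mul hem')
      fun v => by rw [hupd, Function.update_of_ne hmn.symm]]
    refine integral_congr_ae (.of_forall fun ω => ?_)
    beta_reduce
    rw [hphase]
    ring
  have hev : ∀ k : Fin K, Measurable fun v : Fin K → ℝ => ((v k : ℝ) : ℂ) := fun k => by fun_prop
  have k1 := key (fun v => ((v p : ℝ) : ℂ)) (fun v => ((v q : ℝ) : ℂ)) (hev p) (hev q)
  have k2 := key (fun _ => 1) (fun _ => 1) measurable_const measurable_const
  have k3 := key (fun v => ((v p : ℝ) : ℂ)) (fun _ => 1) (hev p) measurable_const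
  have k4 := key (fun _ => 1) (fun v => ((v q : ℝ) : ℂ)) measurable_const (hev q)
  simp only [one_mul, mul_one] at k1 k2 k3 k4
  rw [vecCharFun, k1, k2, k3, k4]
  ring

/-- The Hessian of the log-characteristic function of a source is constant in all entries reached
by two different mixtures. -/
lemma moment_identity (h : IndepMixture μ G s) {m n : Fin N} (hmn : m ≠ n) (l : Fin N)
    (p q : Fin K) (hm : G p m l ≠ 0) (hn : G q n l ≠ 0) (z : Fin K → ℝ) :
    vecCharFun μ (s l) z * ∫ ω, (s l ω p : ℂ) * s l ω q * phase (z ⬝ᵥ s l ω) ∂μ -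
        (∫ ω, (s l ω p : ℂ) * phase (z ⬝ᵥ s l ω) ∂μ) *
          ∫ ω, (s l ω q : ℂ) * phase (z ⬝ᵥ s l ω) ∂μ =
      (∫ ω, s l ω p * s l ω q ∂μ : ℝ) * vecCharFun μ (s l) z ^ 2 := by
  -- Sources other than `l` enter only through constants times the characteristic function; their
  -- sum is fixed by `h0`, the case `z = 0`, where the mixtures are uncorrelated.
  have h1 := h.integral_mixVec_cross hmn l p q z
  have h0 := h.integral_mixVec_mul_mixVec_mul_phase m n l p q 0
  simp only [zero_dotProduct, phase_zero, mul_one] at h0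
  have h00 : ∫ ω, (mixVec G s m ω p : ℂ) * mixVec G s n ω q ∂μ = 0 := by
    have := h.integral_mixVec_mul_mixVec hmn p q
    rw [← Complex.ofReal_inj, ← integral_complex_ofReal] at this
    simpa using this
  rw [h00, ← Finset.add_sum_erase _ _ (Finset.mem_univ l)] at h0
  rw [h.integral_mixVec_mul_mixVec_mul_phase, h.integral_mixVec_mul_phase,
    h.integral_mixVec_mul_phase, ← Finset.add_sum_erase _ _ (Finset.mem_univ l)] at h1
  have hR : ∀ a, ∫ ω, (s a ω p : ℂ) * s a ω q ∂μ = (∫ ω, s a ω p * s a ω q ∂μ : ℝ) := by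
    intro a
    rw [← integral_complex_ofReal]; push_cast; rfl
  have h2 : ∑ a ∈ Finset.univ.erase l, (G p m a : ℂ) * G q n a *
      ∫ ω, (s a ω p : ℂ) * s a ω q * phase (z ⬝ᵥ s l ω) ∂μ =
      (∑ a ∈ Finset.univ.erase l, (G p m a : ℂ) * G q n a *
        ∫ ω, (s a ω p : ℂ) * s a ω q ∂μ) * vecCharFun μ (s l) z := by
    rw [Finset.sum_mul]
    refine Finset.sum_congr rfl fun a ha => ?_
    rw [h.integral_source_mul_self_mul_phase (Finset.ne_of_mem_erase ha), hR]
    ring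
  rw [h2] at h1
  rw [← hR l]
  have hc : (G p m l : ℂ) * G q n l ≠ 0 := mul_ne_zero (by exact_mod_cast hm) (by exact_mod_cast hn)
  refine mul_left_cancel₀ hc ?_
  linear_combination h1 + vecCharFun μ (s l) z ^ 2 * h0

/-- A source component that is spread over two mixtures has no first-order interaction with the
components that occur in one mixture only. -/
lemma integral_source_mul_phase_eq_zero (h : IndepMixture μ G s) {n₁ n₂ : Fin N} (hn : n₁ ≠ n₂)
    (l : Fin N) (p : Fin K) (h₁ : G p n₁ l ≠ 0) (h₂ : G p n₂ l ≠ 0) (z : Fin K → ℝ)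
    (hz : ∀ k, z k ≠ 0 → ∃ i, ∀ n, n ≠ i → G k n l = 0) :
    ∫ ω, (s l ω p : ℂ) * phase (z ⬝ᵥ s l ω) ∂μ = 0 := by
  classical
  set c : Fin N → Fin K → ℝ := fun j k => z k * (G k)⁻¹ l j with hc
  set β : Fin K → ℝ := fun k => if G k n₁ l = 0 then 0 else z k with hβ
  have hsingle : ∀ k, z k ≠ 0 → G k n₁ l ≠ 0 → ∀ n, n ≠ n₁ → G k n l = 0 := by
    intro k hk hk1 n hnn
    obtain ⟨i, hi⟩ := hz k hk
    have : n₁ = i := by by_contra hne; exact hk1 (hi n₁ hne)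
    exact hi n (this ▸ hnn)
  have hsplit : ∀ ω, z ⬝ᵥ s l ω = c n₁ ⬝ᵥ mixVec G s n₁ ω +
      ∑ j ∈ Finset.univ.erase n₁, c j ⬝ᵥ mixVec G s j ω := by
    intro ω
    rw [Finset.add_sum_erase Finset.univ (fun j => c j ⬝ᵥ mixVec G s j ω) (Finset.mem_univ n₁)]
    simp only [dotProduct]
    rw [Finset.sum_comm]
    refine Finset.sum_congr rfl fun k _ => ?_
    rw [h.source_eq l ω k, Finset.mul_sum]
    exact Finset.sum_congr rfl fun j _ => by rw [hc]; ring
  -- In a dataset where column `l` has its only nonzero entry in row `n₁`, the source is a multiple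
  -- of `y_{n₁}`.
  have hβeq : ∀ ω, c n₁ ⬝ᵥ mixVec G s n₁ ω = β ⬝ᵥ s l ω := by
    intro ω
    simp only [dotProduct]
    refine Finset.sum_congr rfl fun k _ => ?_
    by_cases hk : z k = 0
    · simp [hc, hβ, hk]
    by_cases hk1 : G k n₁ l = 0
    · simp [hc, hβ, hk1, (h.inv_eq_zero_iff l n₁ k).2 hk1]
    · simp only [hc, hβ, hk1, if_false]
      rw [h.source_eq l ω k, Finset.sum_eq_single n₁]
      · ring
      · intro n _ hnn
        rw [(h.inv_eq_zero_iff l n k).2 (hsingle k hk hk1 n hnn), zero_mul]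
      · simp
  -- The phase depends on `y_{n₁}` alone, so the centred `y_{n₂}` splits off; its coefficient at
  -- source `l` is nonzero.
  have hx : ∫ ω, (s l ω p : ℂ) * phase (β ⬝ᵥ s l ω) ∂μ = 0 := by
    have h3 := integral_mul_of_update_eq h.indep_mix h.measurable_mixVec n₂
      (f := fun v => ((v p : ℝ) : ℂ)) (g := fun v => phase (c n₁ ⬝ᵥ v n₁)) (by fun_prop)
      (by fun_prop) fun v => by simp [hn]
    rw [integral_complex_ofReal, h.integral_mixVec, Complex.ofReal_zero, zero_mul] at h3
    simp only [hβeq] at h3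
    rw [h.integral_mixVec_mul_phase] at h3
    exact (mul_eq_zero.1 h3).resolve_left (by exact_mod_cast h₂)
  -- For the full phase, `y_{n₁}` is separated from the other mixtures, and its factor vanishes by
  -- `hx`.
  have h4 := integral_mul_of_update_eq h.indep_mix h.measurable_mixVec n₁
    (f := fun v => ((v p : ℝ) : ℂ) * phase (c n₁ ⬝ᵥ v))
    (g := fun v => phase (∑ j ∈ Finset.univ.erase n₁, c j ⬝ᵥ v j)) (by fun_prop)
    (by fun_prop) fun v => by
      congr 1
      exact Finset.sum_congr rfl fun j hj => by
        rw [Function.update_of_ne (Finset.ne_of_mem_erase hj)]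
  simp only [mul_assoc, ← phase_add, ← hsplit] at h4
  simp only [hβeq] at h4
  rw [h.integral_mixVec_mul_phase, h.integral_mixVec_mul_phase, hx, mul_zero, zero_mul] at h4
  exact (mul_eq_zero.1 h4).resolve_left (by exact_mod_cast h₁)

end IndepMixture

namespace IndepMixture

variable {Ω : Type*} [MeasurableSpace Ω] {μ : Measure Ω} [IsProbabilityMeasure μ] {N K : ℕ}
  {G : Fin K → Matrix (Fin N) (Fin N) ℝ} {s : Fin N → Ω → Fin K → ℝ}

lemma gaussianFactor (h : IndepMixture μ G s) (l : Fin N) {α : Finset (Fin K)}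
    (hα : ∀ k, k ∈ α ↔ ∃ n₁ n₂, n₁ ≠ n₂ ∧ G k n₁ l ≠ 0 ∧ G k n₂ l ≠ 0) (z : Fin K → ℝ) :
    vecCharFun μ (s l) z =
      Complex.exp (-((∫ ω, (α.piecewise z 0 ⬝ᵥ s l ω) ^ 2 ∂μ : ℝ) : ℂ) / 2) *
        vecCharFun μ (s l) (α.piecewise 0 z) := by
  refine gaussianFactor_of_moment_identities (h.measurable l) (h.memLp l) ?_ ?_ z
  · intro p hp q hq z
    obtain ⟨m, _, _, hm, _⟩ := (hα p).1 hp
    obtain ⟨n₁, n₂, hn, h₁, h₂⟩ := (hα q).1 hq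
    -- Dataset `q` offers two rows, at least one of which differs from `m`.
    by_cases hmn : m = n₁
    · exact h.moment_identity (hmn ▸ hn) l p q hm h₂ z
    · exact h.moment_identity hmn l p q hm h₁ z
  · intro p hp z hz
    obtain ⟨n₁, n₂, hn, h₁, h₂⟩ := (hα p).1 hp
    refine h.integral_source_mul_phase_eq_zero hn l p h₁ h₂ z fun k hk => ?_
    have hkα : k ∉ α := fun hk' => hk (hz k hk')
    rw [hα] at hkα
    push Not at hkα
    by_cases hex : ∃ i, G k i l ≠ 0
    · obtain ⟨i, hi⟩ := hex
      exact ⟨i, fun n hn => hkα i n hn.symm hi⟩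
    · push Not at hex
      -- The column is zero, so any row index serves.
      exact ⟨l, fun n _ => hex n⟩

/-- If `G r n l = 0`, `second_order` for `l` gives the claim. Otherwise `G r n l' = 0`, and the
relation for `l'` makes coordinates `q` and `r` of `y_n` uncorrelated, which the relation for `l`
transfers to `s_l`. -/
lemma uncorrelated_of_row (h : IndepMixture μ G s) {n l l' : Fin N} {q r : Fin K}
    (hq : G q n l ≠ 0 ∧ G q n l' ≠ 0) (hr : ¬(G r n l ≠ 0 ∧ G r n l' ≠ 0)) :
    ∫ ω, s l ω q * s l ω r ∂μ = 0 := by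
  have hcomm : ∫ ω, s l ω r * s l ω q ∂μ = ∫ ω, s l ω q * s l ω r ∂μ := by simp_rw [mul_comm]
  have h1 := h.second_order l n r q
  rw [hcomm] at h1
  refine (mul_eq_zero.1 (h1.trans ?_)).resolve_left hq.1
  by_cases hrl : G r n l = 0
  · rw [(h.inv_eq_zero_iff l n r).2 hrl, zero_mul]
  · have hrl' : G r n l' = 0 := by
      by_contra h0; exact hr ⟨hrl, h0⟩
    have h2 := h.second_order l' n q r
    rw [hrl', zero_mul] at h2
    have h3 := (mul_eq_zero.1 h2.symm).resolve_left
      (fun h0 => hq.2 ((h.inv_eq_zero_iff l' n q).1 h0))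
    simp_rw [mul_comm (mixVec G s n _ r), h3, mul_zero]

/-- `gaussianFactor` covers the larger set `α'` of datasets where source `l` enters two mixtures;
`uncorrelated_of_row` allows `α` to be split off. -/
lemma hasAlphaGaussianComponent_of_row (h : IndepMixture μ G s)
    (hd : ∀ n, μ.map (s n) ≪ (volume : Measure (Fin K → ℝ))) {n l l' : Fin N} (hll : l ≠ l')
    {α : Finset (Fin K)} (hα : ∀ k, k ∈ α ↔ G k n l ≠ 0 ∧ G k n l' ≠ 0) :
    HasAlphaGaussianComponent μ (s l) α := by
  classical
  rw [hasAlphaGaussianComponent_iff (h.measurable l) (h.memLp l)]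
  refine ⟨isUnit_secondMomentMatrix (h.measurable l) (h.memLp l) (hd l), fun z => ?_⟩
  set α' : Finset (Fin K) :=
    Finset.univ.filter fun k => ∃ n₁ n₂, n₁ ≠ n₂ ∧ G k n₁ l ≠ 0 ∧ G k n₂ l ≠ 0
  have hα' : ∀ k, k ∈ α' ↔ ∃ n₁ n₂, n₁ ≠ n₂ ∧ G k n₁ l ≠ 0 ∧ G k n₂ l ≠ 0 := fun k => by
    simp [α']
  have hsub : α ⊆ α' := by
    intro k hk
    obtain ⟨h1, h2⟩ := (hα k).1 hk
    rw [hα']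
    by_contra hcon
    push Not at hcon
    -- If row `n` held the only nonzero entry of column `l`, orthogonality to row `l'` of the
    -- inverse would force `G k n l' = 0`.
    have h3 := h.sum_inv_mul k l' l
    rw [if_neg hll.symm, Finset.sum_eq_single n] at h3
    · exact (mul_eq_zero.1 h3).elim (fun h0 => h2 ((h.inv_eq_zero_iff l' n k).1 h0)) h1
    · intro b _ hb
      rw [hcon n b hb.symm h1, mul_zero]
    · simp
  have key := gaussianFactor_of_subset (h.memLp l) hsub (fun p hp q hq =>
    h.uncorrelated_of_row ((hα p).1 hp) (fun hc => hq ((hα q).2 hc))) (h.gaussianFactor l hα') z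
  rw [dotProduct_secondMomentMatrix_mulVec (h.memLp l)]
  simp_rw [sum_subtype_mul_eq_dotProduct α (fun k : α => z k)]
  have e : (fun k => if h : k ∈ α then z k else 0) = α.piecewise z 0 := by
    ext k; by_cases hk : k ∈ α <;> simp [hk]
  rw [e]
  exact key

/-- This compares `s_l` with `y_n`; two sources in the same row are then compared through the common
`y_n`. -/
lemma exists_factorization (h : IndepMixture μ G s) (n l : Fin N) :
    ∃ κ : Fin K → ℝ, (∀ q, G q n l ≠ 0 → κ q ≠ 0) ∧ ∀ p q, G p n l ≠ 0 → G q n l ≠ 0 →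
      ∫ ω, s l ω p * s l ω q ∂μ =
        (∫ ω, mixVec G s n ω p * mixVec G s n ω q ∂μ) * (κ p * κ q) := by
  -- `κ` is the square root of the variance ratio, with the sign of the entry of `G`.
  have hex : ∀ q, ∃ κ : ℝ, G q n l ≠ 0 → κ ^ 2 * (∫ ω, mixVec G s n ω q * mixVec G s n ω q ∂μ) =
      (∫ ω, s l ω q * s l ω q ∂μ) ∧ 0 < κ * G q n l := by
    intro q
    have hσ := h.moment_pos l q
    have hτ := h.mixVec_moment_pos n q
    set A := (∫ ω, s l ω q * s l ω q ∂μ) / ∫ ω, mixVec G s n ω q * mixVec G s n ω q ∂μ with hA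
    have hApos : 0 < A := div_pos hσ hτ
    have hAmul : A * (∫ ω, mixVec G s n ω q * mixVec G s n ω q ∂μ) =
        ∫ ω, s l ω q * s l ω q ∂μ := div_mul_cancel₀ _ hτ.ne'
    rcases lt_trichotomy (G q n l) 0 with hg | hg | hg
    · refine ⟨-√A, fun _ => ⟨?_, mul_pos_of_neg_of_neg (neg_neg_of_pos (Real.sqrt_pos.2 hApos)) hg⟩⟩
      rw [neg_sq, Real.sq_sqrt hApos.le, hAmul]
    · exact ⟨0, fun h0 => absurd hg h0⟩
    · refine ⟨√A, fun _ => ⟨?_, mul_pos (Real.sqrt_pos.2 hApos) hg⟩⟩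
      rw [Real.sq_sqrt hApos.le, hAmul]
  choose κ hκ using hex
  refine ⟨κ, fun q hq h0 => ?_, fun p q hp hq => ?_⟩
  · have := (hκ q hq).2
    rw [h0, zero_mul] at this
    exact lt_irrefl _ this
  obtain ⟨hp2, hppos⟩ := hκ p hp
  obtain ⟨hq2, hqpos⟩ := hκ q hq
  have hcs : ∫ ω, s l ω q * s l ω p ∂μ = ∫ ω, s l ω p * s l ω q ∂μ := by simp_rw [mul_comm]
  have hcm : ∫ ω, mixVec G s n ω q * mixVec G s n ω p ∂μ =
      ∫ ω, mixVec G s n ω p * mixVec G s n ω q ∂μ := by simp_rw [mul_comm]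
  have h1 := h.second_order l n p q
  have h2 := h.second_order l n q p
  have h3 := h.second_order l n p p
  have h4 := h.second_order l n q q
  have hτp := h.mixVec_moment_pos n p
  have hτq := h.mixVec_moment_pos n q
  rw [hcs, hcm] at h2
  rw [← hp2] at h3
  rw [← hq2] at h4
  generalize ∫ ω, s l ω p * s l ω q ∂μ = σ at *
  generalize ∫ ω, mixVec G s n ω p * mixVec G s n ω q ∂μ = τ at *
  generalize ∫ ω, mixVec G s n ω p * mixVec G s n ω p ∂μ = tp at *
  generalize ∫ ω, mixVec G s n ω q * mixVec G s n ω q ∂μ = tq at *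
  have e3 : (G p)⁻¹ l n = κ p * (κ p * G p n l) :=
    mul_right_cancel₀ hτp.ne' (by rw [← h3]; ring)
  have e4 : (G q)⁻¹ l n = κ q * (κ q * G q n l) :=
    mul_right_cancel₀ hτq.ne' (by rw [← h4]; ring)
  rw [e3] at h1
  rw [e4] at h2
  by_cases hτ : τ = 0
  · rw [hτ, mul_zero] at h1
    rw [hτ, zero_mul]
    exact (mul_eq_zero.1 h1).resolve_left hq
  -- The relations for `(p, q)` and `(q, p)` share `σ` and `τ`, so the squares agree; the sign
  -- choice makes both bases positive.
  have e5 : (κ p * G p n l) ^ 2 = (κ q * G q n l) ^ 2 :=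
    mul_right_cancel₀ hτ (by linear_combination (-G p n l) * h1 + G q n l * h2)
  have e6 : κ p * G p n l = κ q * G q n l := (pow_left_inj₀ hppos.le hqpos.le two_ne_zero).1 e5
  rw [e6] at h1
  exact mul_left_cancel₀ hq (by rw [h1]; ring)

/-- If some mixture combines two sources in one dataset, these two sources have Gaussian components
with equivalent second-moment matrices. -/
theorem exists_alphaGaussian_of_row (h : IndepMixture μ G s)
    (hd : ∀ n, μ.map (s n) ≪ (volume : Measure (Fin K → ℝ))) {n l l' : Fin N} (hll : l ≠ l')
    {p : Fin K} (hl : G p n l ≠ 0) (hl' : G p n l' ≠ 0) :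
    ∃ α : Finset (Fin K), α.Nonempty ∧ HasAlphaGaussianComponent μ (s l) α ∧
      HasAlphaGaussianComponent μ (s l') α ∧ ∃ d : α → ℝ, (∀ k, d k ≠ 0) ∧
        secondMomentMatrix μ (s l) α =
          Matrix.diagonal d * secondMomentMatrix μ (s l') α * Matrix.diagonal d := by
  classical
  set α : Finset (Fin K) := Finset.univ.filter fun k => G k n l ≠ 0 ∧ G k n l' ≠ 0
  have hα : ∀ k, k ∈ α ↔ G k n l ≠ 0 ∧ G k n l' ≠ 0 := fun k => by simp [α]
  have hα' : ∀ k, k ∈ α ↔ G k n l' ≠ 0 ∧ G k n l ≠ 0 := fun k => by rw [hα, and_comm]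
  obtain ⟨κ, hκ0, hκ⟩ := h.exists_factorization n l
  obtain ⟨κ', hκ0', hκ'⟩ := h.exists_factorization n l'
  refine ⟨α, ⟨p, (hα p).2 ⟨hl, hl'⟩⟩, h.hasAlphaGaussianComponent_of_row hd hll hα,
    h.hasAlphaGaussianComponent_of_row hd hll.symm hα', fun k => κ k / κ' k, fun k => ?_, ?_⟩
  · have hk := (hα k).1 k.2
    exact div_ne_zero (hκ0 k hk.1) (hκ0' k hk.2)
  · ext i j
    have hi := (hα i).1 i.2
    have hj := (hα j).1 j.2
    rw [Matrix.mul_diagonal, Matrix.diagonal_mul]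
    simp only [secondMomentMatrix, Matrix.of_apply]
    rw [hκ i j hi.1 hj.1, hκ' i j hi.2 hj.2]
    have := hκ0' i hi.2
    have := hκ0' j hj.2
    field_simp

end IndepMixture

/-! ### Monomial matrices -/

section Monomial

variable {N : ℕ}

lemma permMatrix_mul_diagonal_apply (σ : Equiv.Perm (Fin N)) (d : Fin N → ℝ) (i j : Fin N) :
    (σ.permMatrix ℝ * Matrix.diagonal d) i j = if σ i = j then d j else 0 := by
  simp [Matrix.mul_diagonal, Equiv.Perm.permMatrix, PEquiv.toMatrix_apply, eq_comm]

/-- An invertible matrix with at most one nonzero entry in each row has a monomial inverse. -/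
lemma inv_eq_permMatrix_mul_diagonal {G : Matrix (Fin N) (Fin N) ℝ} (hG : IsUnit G)
    (h : ∀ n l l', l ≠ l' → G n l ≠ 0 → G n l' = 0) :
    ∃ (σ : Equiv.Perm (Fin N)) (d : Fin N → ℝ), (∀ n, d n ≠ 0) ∧
      G⁻¹ = σ.permMatrix ℝ * Matrix.diagonal d := by
  have hGH : G * G⁻¹ = 1 := Matrix.mul_nonsing_inv _ ((Matrix.isUnit_iff_isUnit_det _).1 hG)
  have hrow : ∀ n, ∃ l, G n l ≠ 0 := by
    intro n
    by_contra hcon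
    push Not at hcon
    have := congrFun (congrFun hGH n) n
    simp [Matrix.mul_apply, hcon] at this
  choose τ hτ using hrow
  -- Row `n` of `G` is supported at `τ n`, so `G * G⁻¹ = 1` determines row `τ n` of the inverse.
  have hH : ∀ n n', G n (τ n) * G⁻¹ (τ n) n' = if n = n' then 1 else 0 := by
    intro n n'
    have h1 := congrFun (congrFun hGH n) n'
    rw [Matrix.mul_apply, Matrix.one_apply, Finset.sum_eq_single (τ n)] at h1
    · exact h1
    · intro b _ hb
      rw [h n (τ n) b hb.symm (hτ n), zero_mul]
    · simp
  have hinj : Function.Injective τ := by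
    intro n n' hnn
    by_contra hne
    have h1 := hH n n'
    have h2 := hH n' n'
    rw [if_neg hne] at h1
    rw [if_pos rfl, ← hnn, (mul_eq_zero.1 h1).resolve_left (hτ n), mul_zero] at h2
    exact zero_ne_one h2
  set e : Equiv.Perm (Fin N) := Equiv.ofBijective τ (Finite.injective_iff_bijective.1 hinj)
  have he : ∀ n, e n = τ n := fun n => rfl
  refine ⟨e.symm, fun n => (G n (τ n))⁻¹, fun n => inv_ne_zero (hτ n), ?_⟩
  ext l n
  obtain ⟨a, rfl⟩ := e.surjective l
  rw [permMatrix_mul_diagonal_apply, Equiv.symm_apply_apply, he]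
  have h1 := hH a n
  split_ifs with han
  · subst han
    rw [if_pos rfl] at h1
    exact eq_inv_of_mul_eq_one_right h1
  · rw [if_neg han] at h1
    exact (mul_eq_zero.1 h1).resolve_left (hτ a)

end Monomial

lemma mixing_mixing {Ω : Type*} {N K V : ℕ} (W A : Fin K → Matrix (Fin N) (Fin N) ℝ)
    (S : Fin N → Ω → Fin K → Fin V → ℝ) :
    mixing W (mixing A S) = mixing (fun k => W k * A k) S := by
  funext n ω k v
  simp only [mixing, Matrix.mul_apply, Finset.mul_sum, Finset.sum_mul]
  rw [Finset.sum_comm]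
  exact Finset.sum_congr rfl fun l _ => Finset.sum_congr rfl fun a _ => by ring

/-! ### The rotation of two sources -/

section Rotation

variable {N : ℕ}

/-- The involution which rotates the components `m` and `n`, after rescaling them by `d`. -/
noncomputable def scaledRotation (m n : Fin N) (d : ℝ) : Matrix (Fin N) (Fin N) ℝ :=
  Matrix.of fun a b =>
    if b = m then (if a = m then √2⁻¹ else if a = n then √2⁻¹ / d else 0)
    else if b = n then (if a = m then √2⁻¹ * d else if a = n then -√2⁻¹ else 0)
    else if a = b then 1 else 0

lemma two_mul_sqrt_inv_sq : 2 * (√2⁻¹ * √2⁻¹ : ℝ) = 1 := by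
  rw [Real.mul_self_sqrt (by norm_num)]; norm_num

lemma sum_scaledRotation_mul {m n : Fin N} (hmn : m ≠ n) (d : ℝ) (u : Fin N → ℝ) (l : Fin N) :
    ∑ a, scaledRotation m n d a l * u a =
      if l = m then √2⁻¹ * u m + √2⁻¹ / d * u n
      else if l = n then √2⁻¹ * d * u m - √2⁻¹ * u n else u l := by
  simp only [scaledRotation, Matrix.of_apply]
  split_ifs with h1 h2
  · rw [Fintype.sum_eq_add m n hmn]
    · simp [hmn.symm]
    · rintro x ⟨hm, hn⟩; simp [hm, hn]
  · rw [Fintype.sum_eq_add m n hmn]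
    · simp [hmn.symm]; ring
    · rintro x ⟨hm, hn⟩; simp [hm, hn]
  · simp

lemma scaledRotation_mul_self {m n : Fin N} (hmn : m ≠ n) {d : ℝ} (hd : d ≠ 0) :
    scaledRotation m n d * scaledRotation m n d = 1 := by
  have h2 := two_mul_sqrt_inv_sq
  -- The transpose is used because `sum_scaledRotation_mul` sums over the row index.
  have hT : (scaledRotation m n d)ᵀ * (scaledRotation m n d)ᵀ = 1 := by
    ext l b
    rw [Matrix.mul_apply]
    simp only [Matrix.transpose_apply]
    rw [sum_scaledRotation_mul hmn d (fun a => scaledRotation m n d b a) l]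
    simp only [scaledRotation, Matrix.of_apply, Matrix.one_apply, if_true, hmn.symm, if_false]
    generalize (√2⁻¹ : ℝ) = c at h2
    by_cases hlm : l = m
    · subst hlm
      by_cases hbl : b = l
      · subst hbl; simp; field_simp; linear_combination h2
      · by_cases hbn : b = n
        · subst hbn; simp [hmn, hmn.symm]; ring
        · simp [hbl, hbn, Ne.symm hbl]
    · by_cases hln : l = n
      · subst hln
        by_cases hbl : b = l
        · subst hbl; simp [hlm]; field_simp; linear_combination h2
        · by_cases hbm : b = m
          · subst hbm; simp [hmn.symm]; ring
          · simp [hbl, hbm, hlm, Ne.symm hbl]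
      · by_cases hbl : b = l
        · subst hbl; simp [hlm, hln]
        · simp [hlm, hln, hbl, Ne.symm hbl]
  rw [← Matrix.transpose_mul] at hT
  simpa using congrArg Matrix.transpose hT

/-- The parallelogram law for a quadratic form. -/
lemma quadratic_rotation {ι : Type*} [Fintype ι] (R : Matrix ι ι ℝ) (x y : ι → ℝ) :
    (√2⁻¹ • (x + y)) ⬝ᵥ R *ᵥ (√2⁻¹ • (x + y)) + (√2⁻¹ • (x - y)) ⬝ᵥ R *ᵥ (√2⁻¹ • (x - y)) =
      x ⬝ᵥ R *ᵥ x + y ⬝ᵥ R *ᵥ y := by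
  simp only [Matrix.mulVec_smul, Matrix.mulVec_add, Matrix.mulVec_sub, dotProduct_smul,
    smul_dotProduct, dotProduct_add, add_dotProduct, dotProduct_sub, sub_dotProduct, smul_eq_mul]
  linear_combination (x ⬝ᵥ R *ᵥ x + y ⬝ᵥ R *ᵥ y) * two_mul_sqrt_inv_sq

lemma quadratic_diagonal {ι : Type*} [Fintype ι] [DecidableEq ι] (R : Matrix ι ι ℝ) (d x : ι → ℝ) :
    x ⬝ᵥ (Matrix.diagonal d * R * Matrix.diagonal d) *ᵥ x = (d * x) ⬝ᵥ R *ᵥ (d * x) := by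
  have h1 : Matrix.diagonal d *ᵥ x = d * x := by ext i; simp [Matrix.mulVec_diagonal]
  have h2 : x ᵥ* Matrix.diagonal d = d * x := by
    ext i; simp [Matrix.vecMul_diagonal, mul_comm]
  rw [← Matrix.mulVec_mulVec, h1, ← Matrix.mulVec_mulVec, Matrix.dotProduct_mulVec, h2]

end Rotation

/-! ### Invariance of the joint law -/

section Law

variable {Ω : Type*} [MeasurableSpace Ω] {μ : Measure Ω} [IsProbabilityMeasure μ] {N K : ℕ}

lemma map_eq_of_integral_phase_eq {x y : Ω → Fin N → Fin K → ℝ} (hx : Measurable x)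
    (hy : Measurable y) (h : ∀ u : Fin N → Fin K → ℝ,
      ∫ ω, phase (∑ n, u n ⬝ᵥ x ω n) ∂μ = ∫ ω, phase (∑ n, u n ⬝ᵥ y ω n) ∂μ) :
    μ.map x = μ.map y := by
  have hm : ∀ z : Ω → Fin N → Fin K → ℝ, Measurable z →
      Measurable fun ω (i : Fin N × Fin K) => z ω i.1 i.2 := fun z hz =>
    measurable_pi_lambda _ fun i =>
      (measurable_pi_apply i.2).comp ((measurable_pi_apply i.1).comp hz)
  have h1 := map_eq_of_vecCharFun_eq (μ := μ) (ν := μ) (hm x hx) (hm y hy) fun z => by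
    have := h fun n k => z (n, k)
    simpa only [vecCharFun, dotProduct, Fintype.sum_prod_type] using this
  have hc : Measurable fun (f : Fin N × Fin K → ℝ) n k => f (n, k) := by fun_prop
  have h2 := congrArg (Measure.map fun (f : Fin N × Fin K → ℝ) n k => f (n, k)) h1
  rw [Measure.map_map hc (hm x hx), Measure.map_map hc (hm y hy)] at h2
  exact h2

omit [IsProbabilityMeasure μ] in
lemma integral_phase_sum_eq_prod {s : Fin N → Ω → Fin K → ℝ} (hs : ∀ n, Measurable (s n))
    (hi : iIndepFun s μ) (z : Fin N → Fin K → ℝ) :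
    ∫ ω, phase (∑ n, z n ⬝ᵥ s n ω) ∂μ = ∏ n, vecCharFun μ (s n) (z n) := by
  simp only [phase_sum]
  exact hi.integral_fun_prod_comp (f := fun n v => phase (z n ⬝ᵥ v))
    (fun n => (hs n).aemeasurable) (fun n => by fun_prop)

/-- The joint characteristic function is a product over the sources, and mixing by `T` acts on its
argument by the transpose. -/
lemma map_mixVec_eq {s : Fin N → Ω → Fin K → ℝ} (hs : ∀ n, Measurable (s n))
    (hi : iIndepFun s μ) {T : Fin K → Matrix (Fin N) (Fin N) ℝ}
    (h : ∀ u : Fin N → Fin K → ℝ, ∏ l, vecCharFun μ (s l) (fun k => ∑ n, T k n l * u n k) =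
      ∏ l, vecCharFun μ (s l) (u l)) :
    μ.map (fun ω n => mixVec T s n ω) = μ.map (fun ω n => s n ω) := by
  have hsm : ∀ l k, Measurable fun ω => s l ω k := fun l k => (measurable_pi_apply k).comp (hs l)
  refine map_eq_of_integral_phase_eq ?_ (measurable_pi_lambda _ hs) fun u => ?_
  · unfold mixVec
    fun_prop
  · rw [integral_phase_sum_eq_prod hs hi, ← h, ← integral_phase_sum_eq_prod hs hi]
    refine integral_congr_ae (.of_forall fun ω => ?_)
    beta_reduce
    congr 1
    simp only [dotProduct, mixVec, Finset.mul_sum, Finset.sum_mul]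
    rw [Finset.sum_comm]
    conv_rhs => rw [Finset.sum_comm]
    refine Finset.sum_congr rfl fun k _ => ?_
    rw [Finset.sum_comm]
    exact Finset.sum_congr rfl fun l _ => Finset.sum_congr rfl fun n _ => by ring

/-- Rotating two sources inside a common Gaussian component does not change their joint law. -/
lemma map_mixVec_scaledRotation {s : Fin N → Ω → Fin K → ℝ} (hs : ∀ n, Measurable (s n))
    (h2 : ∀ n k, MemLp (fun ω => s n ω k) 2 μ) (hi : iIndepFun s μ) {α : Finset (Fin K)}
    {m n : Fin N} (hmn : m ≠ n) (hm : HasAlphaGaussianComponent μ (s m) α)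
    (hn : HasAlphaGaussianComponent μ (s n) α) {d : α → ℝ} (hd : ∀ k, d k ≠ 0)
    (hR : secondMomentMatrix μ (s m) α =
      Matrix.diagonal d * secondMomentMatrix μ (s n) α * Matrix.diagonal d) :
    μ.map (fun ω j => mixVec (fun k => if hk : k ∈ α then scaledRotation m n (d ⟨k, hk⟩) else 1)
      s j ω) = μ.map (fun ω j => s j ω) := by
  refine map_mixVec_eq hs hi fun u => ?_
  set z : Fin N → Fin K → ℝ := fun l k => ∑ a,
    (if hk : k ∈ α then scaledRotation m n (d ⟨k, hk⟩) else 1 : Matrix (Fin N) (Fin N) ℝ) a l *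
      u a k with hz
  have hzα : ∀ (l : Fin N) (k : α), z l k = if l = m then √2⁻¹ * u m k + √2⁻¹ / d k * u n k
      else if l = n then √2⁻¹ * d k * u m k - √2⁻¹ * u n k else u l k := by
    intro l k
    simp only [hz, k.2, dite_true]
    exact sum_scaledRotation_mul hmn (d k) (fun a => u a k) l
  have hzc : ∀ l k, k ∉ α → z l k = u l k := by
    intro l k hk
    simp [hz, hk, Matrix.one_apply]
  have hpw : ∀ l, α.piecewise 0 (z l) = α.piecewise 0 (u l) := by
    intro l; ext k
    by_cases hk : k ∈ α
    · simp [hk]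
    · simp [hk, hzc l k hk]
  have hother : ∀ l, l ≠ m → l ≠ n → z l = u l := by
    intro l hlm hln
    ext k
    by_cases hk : k ∈ α
    · simpa [hlm, hln] using hzα l ⟨k, hk⟩
    · exact hzc l k hk
  have gm := ((hasAlphaGaussianComponent_iff (hs m) (h2 m)).1 hm).2
  have gn := ((hasAlphaGaussianComponent_iff (hs n) (h2 n)).1 hn).2
  -- In the frequencies `x = d u_m` and `y = u_n` both exponents use the moment matrix of `s_n`, and
  -- the transformed pair is `(x ± y) / √2`.
  set x : α → ℝ := d * fun k : α => u m k with hx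
  set y : α → ℝ := fun k => u n k with hy
  have em : (d * fun k : α => z m k) = √2⁻¹ • (x + y) := by
    ext k
    have := hd k
    simp only [Pi.mul_apply, hzα, if_true, hx, hy, Pi.smul_apply, Pi.add_apply, smul_eq_mul]
    field_simp
  have en : (fun k : α => z n k) = √2⁻¹ • (x - y) := by
    ext k
    simp only [hzα, hmn.symm, if_true, if_false, hx, hy, Pi.smul_apply, Pi.sub_apply, Pi.mul_apply,
      smul_eq_mul]
    ring
  have hpair : vecCharFun μ (s m) (z m) * vecCharFun μ (s n) (z n) =
      vecCharFun μ (s m) (u m) * vecCharFun μ (s n) (u n) := by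
    rw [gm (z m), gn (z n), gm (u m), gn (u n), hpw, hpw, hR, quadratic_diagonal,
      quadratic_diagonal, em, en]
    have key := quadratic_rotation (secondMomentMatrix μ (s n) α) x y
    have hexp : ∀ a b c e : ℝ, a + b = c + e →
        Complex.exp (-(a : ℂ) / 2) * Complex.exp (-(b : ℂ) / 2) =
        Complex.exp (-(c : ℂ) / 2) * Complex.exp (-(e : ℂ) / 2) := by
      intro a b c e habce
      rw [← Complex.exp_add, ← Complex.exp_add]
      congr 1
      have : (a : ℂ) + b = c + e := by exact_mod_cast habce
      linear_combination (-1 / 2) * this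
    linear_combination (vecCharFun μ (s m) (α.piecewise 0 (u m)) *
      vecCharFun μ (s n) (α.piecewise 0 (u n))) * hexp _ _ _ _ key
  have hmem : n ∈ Finset.univ.erase m := Finset.mem_erase.2 ⟨hmn.symm, Finset.mem_univ n⟩
  rw [← Finset.mul_prod_erase _ _ (Finset.mem_univ m), ← Finset.mul_prod_erase _ _ hmem,
    ← Finset.mul_prod_erase Finset.univ (fun l => vecCharFun μ (s l) (u l)) (Finset.mem_univ m),
    ← Finset.mul_prod_erase _ (fun l => vecCharFun μ (s l) (u l)) hmem, ← mul_assoc, ← mul_assoc]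
  refine congrArg₂ _ hpair (Finset.prod_congr rfl fun l hl => ?_)
  rw [Finset.mem_erase, Finset.mem_erase] at hl
  exact congrArg _ (hother l hl.2.1 hl.1)

end Law

/-! ### From laws of samples to identifiability -/

section Identifiability

variable {Ω : Type*} [MeasurableSpace Ω] {μ : Measure Ω} {N K V : ℕ}

lemma iIndepFun_of_map_eq [IsProbabilityMeasure μ] {ι : Type*} [Fintype ι] {E : Type*} [MeasurableSpace E]
    {x y : ι → Ω → E} (hx : ∀ i, Measurable (x i)) (hy : ∀ i, Measurable (y i))
    (hi : iIndepFun x μ) (h : μ.map (fun ω i => y i ω) = μ.map (fun ω i => x i ω)) :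
    iIndepFun y μ := by
  have hm : ∀ i, μ.map (y i) = μ.map (x i) := fun i => by
    have := congrArg (Measure.map fun v : ι → E => v i) h
    rwa [Measure.map_map (measurable_pi_apply i) (measurable_pi_lambda _ hy),
      Measure.map_map (measurable_pi_apply i) (measurable_pi_lambda _ hx)] at this
  rw [iIndepFun_iff_map_fun_eq_pi_map fun i => (hy i).aemeasurable, h,
    hi.map_fun_eq_pi_map fun i => (hx i).aemeasurable]
  simp_rw [hm]

lemma iIndepFun_sample {S : Fin N → Ω → Fin K → Fin V → ℝ} (hi : iIndepFun S μ) (v : Fin V) :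
    iIndepFun (fun n ω k => S n ω k v) μ :=
  hi.comp (fun _ (f : Fin K → Fin V → ℝ) k => f k v) fun _ => by fun_prop

/-- A linear transformation that preserves the law of one sample preserves the independence of the
source component matrices. -/
lemma iIndepFun_mixing_of_map_eq [IsProbabilityMeasure μ] {S : Fin N → Ω → Fin K → Fin V → ℝ}
    (hmeas : ∀ n, Measurable (S n)) (hsources : iIndepFun S μ)
    (hindep : iIndepFun (fun v ω (n : Fin N) (k : Fin K) => S n ω k v) μ)
    (hident : ∀ v w, IdentDistrib (fun ω (n : Fin N) (k : Fin K) => S n ω k v)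
      (fun ω (n : Fin N) (k : Fin K) => S n ω k w) μ μ)
    (T : Fin K → Matrix (Fin N) (Fin N) ℝ) (v₀ : Fin V)
    (hT : μ.map (fun ω n => mixVec T (fun n ω k => S n ω k v₀) n ω) =
      μ.map (fun ω n k => S n ω k v₀)) :
    iIndepFun (mixing T S) μ := by
  have hSm : ∀ n k v, Measurable fun ω => S n ω k v := fun n k v =>
    (measurable_pi_apply v).comp ((measurable_pi_apply k).comp (hmeas n))
  set X : Fin V → Ω → Fin N → Fin K → ℝ := fun v ω n k => S n ω k v with hX
  have hXm : ∀ v, Measurable (X v) := fun v => by fun_prop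
  set Φ : (Fin N → Fin K → ℝ) → Fin N → Fin K → ℝ := fun x n k => ∑ l, T k n l * x l k with hΦ
  have hΦm : Measurable Φ := by fun_prop
  have hΦX : ∀ v, Measurable fun ω => Φ (X v ω) := fun v => hΦm.comp (hXm v)
  have hν : ∀ v, (μ.map (X v)).map Φ = μ.map (X v) := by
    intro v
    rw [(hident v v₀).map_eq, Measure.map_map hΦm (hXm v₀)]
    exact hT
  -- Both laws are products over the samples with equal factors; `hρ` then regroups the entries by
  -- source.
  have hlaw : μ.map (fun ω v => Φ (X v ω)) = μ.map (fun ω v => X v ω) := by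
    have h1 := hindep.map_fun_eq_pi_map fun v => (hXm v).aemeasurable
    have h2 : iIndepFun (fun v ω => Φ (X v ω)) μ := hindep.comp (fun _ => Φ) fun _ => hΦm
    rw [h2.map_fun_eq_pi_map fun v => (hΦX v).aemeasurable, h1]
    congr 1
    funext v
    exact (Measure.map_map hΦm (hXm v)).symm.trans (hν v)
  have hρ : Measurable fun (f : Fin V → Fin N → Fin K → ℝ) (n : Fin N) (k : Fin K) (v : Fin V) =>
      f v n k := by fun_prop
  have h3 := congrArg (Measure.map fun (f : Fin V → Fin N → Fin K → ℝ) (n : Fin N) (k : Fin K)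
    (v : Fin V) => f v n k) hlaw
  rw [Measure.map_map hρ (measurable_pi_lambda _ hΦX),
    Measure.map_map hρ (measurable_pi_lambda _ hXm)] at h3
  refine iIndepFun_of_map_eq hmeas (fun n => ?_) hsources h3
  unfold mixing
  fun_prop

/-- For `W = T A⁻¹` the inverse is `A T`, as `T` is an involution. Identifiability would make `T k`
monomial, but its row `m` has two nonzero entries. -/
lemma not_sourcesIdentifiable_of_mixing {A T : Fin K → Matrix (Fin N) (Fin N) ℝ}
    (hA : ∀ k, IsUnit (A k)) (hT : ∀ k, T k * T k = 1) {S : Fin N → Ω → Fin K → Fin V → ℝ}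
    (hi : iIndepFun (mixing T S) μ) {k : Fin K} {m n : Fin N} (hmn : m ≠ n)
    (hm : T k m m ≠ 0) (hn : T k m n ≠ 0) : ¬ SourcesIdentifiable μ A S := by
  intro hid
  have hdet := fun k => (Matrix.isUnit_iff_isUnit_det _).1 (hA k)
  have hTu : ∀ k, IsUnit (T k) := fun k => IsUnit.of_mul_eq_one _ (hT k)
  have hWA : (fun k => T k * (A k)⁻¹ * A k) = T := by
    funext k
    rw [Matrix.mul_assoc, Matrix.nonsing_inv_mul _ (hdet k), Matrix.mul_one]
  obtain ⟨σ, d, -, hσ⟩ := hid (fun k => T k * (A k)⁻¹)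
    (fun k => (hTu k).mul ((Matrix.isUnit_nonsing_inv_iff).2 (hA k)))
    (by rw [mixing_mixing, hWA]; exact hi) k
  have hTinv : (T k)⁻¹ = T k := Matrix.inv_eq_left_inv (hT k)
  rw [Matrix.mul_inv_rev, Matrix.nonsing_inv_nonsing_inv _ (hdet k), hTinv, Matrix.mul_assoc] at hσ
  have h1 : T k = σ.permMatrix ℝ * Matrix.diagonal d := by
    have := congrArg ((A k)⁻¹ * ·) hσ
    simpa only [← Matrix.mul_assoc, Matrix.nonsing_inv_mul _ (hdet k), Matrix.one_mul] using this
  rw [h1, permMatrix_mul_diagonal_apply] at hm hn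
  have e1 : σ m = m := by by_contra h; simp [h] at hm
  have e2 : σ m = n := by by_contra h; simp [h] at hn
  exact hmn (e1.symm.trans e2)

/-- Non-identifiable sources admit demixing matrices for which some estimated component combines two
sources of the same dataset. -/
lemma exists_row_of_not_sourcesIdentifiable {A : Fin K → Matrix (Fin N) (Fin N) ℝ}
    (hA : ∀ k, IsUnit (A k)) {S : Fin N → Ω → Fin K → Fin V → ℝ}
    (h : ¬ SourcesIdentifiable μ A S) :
    ∃ G : Fin K → Matrix (Fin N) (Fin N) ℝ, (∀ k, IsUnit (G k)) ∧ iIndepFun (mixing G S) μ ∧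
      ∃ k n l l', l ≠ l' ∧ G k n l ≠ 0 ∧ G k n l' ≠ 0 := by
  unfold SourcesIdentifiable at h
  push Not at h
  obtain ⟨W, hW, hi, k, hk⟩ := h
  have hG : ∀ k, IsUnit (W k * A k) := fun k => (hW k).mul (hA k)
  refine ⟨fun k => W k * A k, hG, by rwa [← mixing_mixing], k, ?_⟩
  by_contra hcon
  push Not at hcon
  obtain ⟨σ, d, hd, hσ⟩ := inv_eq_permMatrix_mul_diagonal (hG k) hcon
  refine hk σ d hd ?_
  rw [Matrix.mul_assoc, ← hσ, Matrix.mul_inv_rev, ← Matrix.mul_assoc,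
    Matrix.mul_nonsing_inv _ ((Matrix.isUnit_iff_isUnit_det _).1 (hA k)), Matrix.one_mul]

end Identifiability

theorem theorem3 {Ω : Type*} [MeasurableSpace Ω] (μ : Measure Ω) [IsProbabilityMeasure μ]
    {N K V : ℕ}
    -- the invertible mixing matrices and the source component matrices
    (A : Fin K → Matrix (Fin N) (Fin N) ℝ) (hA : ∀ k, IsUnit (A k))
    (S : Fin N → Ω → Fin K → Fin V → ℝ) (hmeas : ∀ n, Measurable (S n))
    -- different sources are independent
    (hsources : iIndepFun S μ)
    -- the `V` samples are independent and identically distributed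
    (hindep : iIndepFun (fun v ω (n : Fin N) (k : Fin K) => S n ω k v) μ)
    (hident : ∀ v w, IdentDistrib (fun ω (n : Fin N) (k : Fin K) => S n ω k v)
      (fun ω (n : Fin N) (k : Fin K) => S n ω k w) μ μ)
    -- each source vector has a density, finite second moments and zero mean
    (hdensity : ∀ n v, μ.map (fun ω k => S n ω k v) ≪ (volume : Measure (Fin K → ℝ)))
    (hmoment : ∀ n k v, MemLp (fun ω => S n ω k v) 2 μ)
    (hmean : ∀ n k v, ∫ ω, S n ω k v ∂μ = 0)
    -- `v₀` is any one of the samples (so there is at least one)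
    (v₀ : Fin V) :
    ¬ SourcesIdentifiable μ A S ↔
      ∃ α : Finset (Fin K), α.Nonempty ∧ ∃ m n : Fin N, m ≠ n ∧
        HasAlphaGaussianComponent μ (fun ω k => S m ω k v₀) α ∧
        HasAlphaGaussianComponent μ (fun ω k => S n ω k v₀) α ∧
        ∃ d : α → ℝ, (∀ k, d k ≠ 0) ∧
          secondMomentMatrix μ (fun ω k => S m ω k v₀) α =
            Matrix.diagonal d * secondMomentMatrix μ (fun ω k => S n ω k v₀) α *
              Matrix.diagonal d := by
  have hsm : ∀ n, Measurable fun ω k => S n ω k v₀ := fun n =>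
    measurable_pi_lambda _ fun k =>
      (measurable_pi_apply v₀).comp ((measurable_pi_apply k).comp (hmeas n))
  have hsi := iIndepFun_sample hsources v₀
  constructor
  · intro h
    obtain ⟨G, hG, hi, k, n, l, l', hll, hl, hl'⟩ := exists_row_of_not_sourcesIdentifiable hA h
    have hmix : IndepMixture μ G (fun n ω k => S n ω k v₀) :=
      { measurable := hsm
        memLp := fun n k => hmoment n k v₀
        mean := fun n k => hmean n k v₀
        indep := hsi
        indep_mix := iIndepFun_sample hi v₀
        isUnit := hG
        moment_pos := fun n k => by
          have := integral_dotProduct_sq_pos (w := Pi.single k 1) (hsm n)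
            (fun k => hmoment n k v₀) (hdensity n v₀)
            (fun h0 => one_ne_zero (α := ℝ) (by simpa using congrFun h0 k))
          simpa [← sq] using this }
    obtain ⟨α, hα, h1, h2, d, hd, hR⟩ :=
      hmix.exists_alphaGaussian_of_row (fun n => hdensity n v₀) hll hl hl'
    exact ⟨α, hα, l, l', hll, h1, h2, d, hd, hR⟩
  · rintro ⟨α, ⟨k, hk⟩, m, n, hmn, hm, hn, d, hd, hR⟩
    have hlaw := map_mixVec_scaledRotation (s := fun n ω k => S n ω k v₀) hsm
      (fun n k => hmoment n k v₀) hsi hmn hm hn hd hR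
    have hi := iIndepFun_mixing_of_map_eq hmeas hsources hindep hident _ v₀ hlaw
    have hc : √(2⁻¹ : ℝ) ≠ 0 := (Real.sqrt_pos.2 (by norm_num)).ne'
    refine not_sourcesIdentifiable_of_mixing hA (fun j => ?_) hi (k := k) hmn ?_ ?_
    · by_cases hj : j ∈ α
      · simpa only [hj, dite_true] using scaledRotation_mul_self hmn (hd ⟨j, hj⟩)
      · simp only [hj, dite_false, Matrix.one_mul]
    · simpa only [hk, dite_true, scaledRotation, Matrix.of_apply, if_true] using hc
    · simpa only [hk, dite_true, scaledRotation, Matrix.of_apply, if_true, hmn.symm, if_false]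
        using mul_ne_zero hc (hd ⟨k, hk⟩)
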